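/- Let $\mathbb{K}$ be a field of characteristic $0$ and $\mathfrak{C}$ a non-empty set of colours. Let $\mathcal{P}(\mathfrak{C})$ be the groupoid of finite sequences (profiles) of colours with permutations as morphisms, and $\mathcal{S}(\mathfrak{C})=\mathcal{P}(\mathfrak{C})^{op}\times\mathcal{P}(\mathfrak{C})$, whose objects $\binom{\underline d}{\underline c}$ are pairs of an input profile $\underline c$ and an output profile $\underline d$. All operads below are symmetric, reduced (no operations without inputs), non-unital operads over $\mathbb{K}$, coloured by a groupoid and concentrated in degree $0$; $F(E)/\langle R\rangle$ is the quotient of the free such operad on a groupoid coloured module $E$ by the operadic ideal generated by $R$. A graph means a directed $\mathfrak{C}$-coloured graph with labelled vertices, with ordered inputs and outputs at each vertex and of the whole graph, in which every wire meets a vertex; its vertices and the graph itself have profiles in $\mathcal{S}(\mathfrak{C})$. Let $\mathbb{W}=F(E)/\langle R\rangle$ be the $\mathcal{S}(\mathfrak{C})$-coloured operad governing non-unital wheeled props: $E$ is spanned by the extended horizontal compositions $(\otimes_h,\binom{\sigma}{\tau})$ (graphs with two vertices and no internal edge) and the extended contractions $(\xi^i_j,\binom{\sigma}{\tau})$ (graphs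 with one vertex and exactly one internal edge, a loop), the input profile of a generator being the list of profiles of its vertices and its output colour the profile of the graph, with the groupoid acting by relabelling; $R$ equates any two composites of two generators that form the same graph (i.e. associativity of $\otimes_h$, compatibility of $\otimes_h$ with contractions, and commutativity of contractions). Let $\mathbb{P}$ be the operad governing non-unital props, defined in the same way from the extended horizontal compositions and the extended properadic compositions in both directions (graphs with two vertices and at least one internal edge, all internal edges being directed from one of the vertices to the other); its relations again equate all composites of two generators that form the same (wheel-free, three-vertex) graph. Let $Com$ be the non-unital commutative operad, with one colour: $Com(n)=\mathbb{K}$ with trivial $\Sigma_n$-action for $n\ge 2$, $Com(1)=0$, and composition given by multiplication of scalars. For each of $O=\mathbb{W}$ and $O=\mathbb{P}$, let $\eta=(\otimes_h,\binom{id_\varnothing}{id_\varnothing})\in O\bigl(\binom{\varnothing}{\varnothing},\binom{\varnothing}{\varnothing};\binom{\varnothing}{\varnothing}\bigr)$ be the horizontal composition of two vertices with empty profiles, and let $\mathbb{H}\subseteq O$ be the suboperad generated by $\eta$. Then: 1. the $\Sigma_2$-action on $\eta$ is trivial, and $\eta$ is associative: $\eta\circ_1\eta=\eta\circ_2\eta$;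 2. $\mathbb{H}$ has no non-zero operations involving a colour other than $\binom{\varnothing}{\varnothing}$, and $Com$ is isomorphic to $\mathbb{H}$, as groupoid coloured operads, by an isomorphism that sends the one colour of $Com$ to $\binom{\varnothing}{\varnothing}$ and the commutative product in $Com(2)$ to $\eta$; 3. $\eta$ satisfies no relations other than the consequences of its symmetry and horizontal associativity: if $F(\mu)$ is the free one-coloured operad on one binary generator $\mu$ with trivial $\Sigma_2$-action, the assignment $\mu\mapsto\eta$ induces an isomorphism $F(\mu)/\langle \mu\circ_1\mu-\mu\circ_2\mu\rangle\cong\mathbb{H}$. In particular $Com$ is isomorphic to a suboperad of both $\mathbb{W}$ and $\mathbb{P}$. -/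

import Mathlib

open CategoryTheory

universe u v w x

/-! ### Non-empty input profiles of a groupoid coloured operad -/

/-- A non-empty finite family of objects of `V`: the input profile of an operation.  The inputs are
labelled by an arbitrary finite set; the profiles `(v₁, …, vₙ)` are the case `ι = Fin n`.  Operations
without inputs do not occur (all modules are reduced). -/
structure Arity (V : Type u) : Type (max 1 u) where
  ι : Type
  [fin : Finite ι]
  [ne : Nonempty ι]
  col : ι → V

attribute [instance] Arity.fin Arity.ne

namespace Arity

/-- A morphism of the wreath groupoid `𝕍ⁿ ⋊ Σₙ`: a bijection of labels together with a morphism of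
`V` for each label. -/
@[ext]
structure Hom {V : Type u} [Category.{v} V] (A B : Arity V) where
  e : A.ι ≃ B.ι
  f : ∀ i, A.col i ⟶ B.col (e i)

instance {V : Type u} [Category.{v} V] : Category (Arity V) where
  Hom A B := Hom A B
  id A := ⟨Equiv.refl _, fun i => 𝟙 (A.col i)⟩
  comp g h := ⟨g.e.trans h.e, fun i => g.f i ≫ h.f (g.e i)⟩
  id_comp g := by
    refine Hom.ext rfl (heq_of_eq (funext fun i => ?_))
    exact Category.id_comp _
  comp_id g := by
    refine Hom.ext rfl (heq_of_eq (funext fun i => ?_))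
    exact Category.comp_id _
  assoc g h k := by
    refine Hom.ext rfl (heq_of_eq (funext fun i => ?_))
    exact Category.assoc _ _ _

/-- The profile with all inputs of the same colour. -/
abbrev const {V : Type u} (ι : Type) [Finite ι] [Nonempty ι] (a : V) : Arity V where
  ι := ι
  col := fun _ => a

/-- The action of a bijection of labels on a profile with constant colour. -/
def constHom {V : Type u} [Category.{v} V] {ι κ : Type} [Finite ι] [Nonempty ι] [Finite κ]
    [Nonempty κ] (e : ι ≃ κ) (a : V) : const ι a ⟶ const κ a :=
  ⟨e, fun _ => 𝟙 a⟩

/-- The profile `A ∘ᵢ B`: the input `i` of `A` is replaced by the inputs of `B`. -/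
abbrev subst {V : Type u} (A : Arity V) (i : A.ι) (B : Arity V) : Arity V where
  ι := {a : A.ι // a ≠ i} ⊕ B.ι
  col := Sum.elim (fun a => A.col a.1) B.col

section

variable {V : Type u} [Category.{v} V]

/-- Functoriality of `A ∘ᵢ B`. -/
def substHom {A' A B' B : Arity V} (g : A' ⟶ A) (i : A'.ι) (h : B' ⟶ B) :
    A'.subst i B' ⟶ A.subst (g.e i) B where
  e := Equiv.sumCongr (g.e.subtypeEquiv (fun a => by simp)) h.e
  f := fun x => match x with
    | Sum.inl a => g.f a.1
    | Sum.inr b => h.f b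

/-- The label bijection `(A ∘ᵢ B) ∘ⱼ D ≅ A ∘ᵢ (B ∘ⱼ D)`. -/
def seqEquiv (A : Arity V) (i : A.ι) (B : Arity V) (j : B.ι) (D : Arity V) :
    ((A.subst i B).subst (Sum.inr j) D).ι ≃ (A.subst i (B.subst j D)).ι where
  toFun := fun x => match x with
    | Sum.inl ⟨Sum.inl a, _⟩ => Sum.inl a
    | Sum.inl ⟨Sum.inr b, hb⟩ => Sum.inr (Sum.inl ⟨b, fun h => hb (h ▸ rfl)⟩)
    | Sum.inr d => Sum.inr (Sum.inr d)
  invFun := fun x => match x with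
    | Sum.inl a => Sum.inl ⟨Sum.inl a, fun h => Sum.inl_ne_inr h⟩
    | Sum.inr (Sum.inl b) => Sum.inl ⟨Sum.inr b.1, fun h => b.2 (Sum.inr_injective h)⟩
    | Sum.inr (Sum.inr d) => Sum.inr d
  left_inv := by rintro (⟨a | b, h⟩ | d) <;> rfl
  right_inv := by rintro (a | b | d) <;> rfl

/-- The isomorphism `(A ∘ᵢ B) ∘ⱼ D ≅ A ∘ᵢ (B ∘ⱼ D)`. -/
def seqHom (A : Arity V) (i : A.ι) (B : Arity V) (j : B.ι) (D : Arity V) :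
    (A.subst i B).subst (Sum.inr j) D ⟶ A.subst i (B.subst j D) where
  e := seqEquiv A i B j D
  f := fun x => match x with
    | Sum.inl ⟨Sum.inl a, _⟩ => 𝟙 (A.col a.1)
    | Sum.inl ⟨Sum.inr b, _⟩ => 𝟙 (B.col b)
    | Sum.inr d => 𝟙 (D.col d)

/-- The label bijection `(A ∘ᵢ B) ∘ₖ D ≅ (A ∘ₖ D) ∘ᵢ B` for `i ≠ k`. -/
def parEquiv (A : Arity V) (i k : A.ι) (hik : i ≠ k) (B D : Arity V) :
    ((A.subst i B).subst (Sum.inl ⟨k, hik.symm⟩) D).ι ≃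
      ((A.subst k D).subst (Sum.inl ⟨i, hik⟩) B).ι where
  toFun := fun x => match x with
    | Sum.inl ⟨Sum.inl a, ha⟩ =>
        Sum.inl ⟨Sum.inl ⟨a.1, fun h => ha (congrArg Sum.inl (Subtype.ext h))⟩,
          fun h => a.2 (congrArg Subtype.val (Sum.inl_injective h))⟩
    | Sum.inl ⟨Sum.inr b, _⟩ => Sum.inr b
    | Sum.inr d => Sum.inl ⟨Sum.inr d, fun h => Sum.inr_ne_inl h⟩
  invFun := fun x => match x with
    | Sum.inl ⟨Sum.inl a, ha⟩ =>
        Sum.inl ⟨Sum.inl ⟨a.1, fun h => ha (congrArg Sum.inl (Subtype.ext h))⟩,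
          fun h => a.2 (congrArg Subtype.val (Sum.inl_injective h))⟩
    | Sum.inl ⟨Sum.inr d, _⟩ => Sum.inr d
    | Sum.inr b => Sum.inl ⟨Sum.inr b, fun h => Sum.inr_ne_inl h⟩
  left_inv := by rintro (⟨a | b, h⟩ | d) <;> rfl
  right_inv := by rintro (⟨a | d, h⟩ | b) <;> rfl

/-- The isomorphism `(A ∘ᵢ B) ∘ₖ D ≅ (A ∘ₖ D) ∘ᵢ B` for `i ≠ k`. -/
def parHom (A : Arity V) (i k : A.ι) (hik : i ≠ k) (B D : Arity V) :
    (A.subst i B).subst (Sum.inl ⟨k, hik.symm⟩) D ⟶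
      (A.subst k D).subst (Sum.inl ⟨i, hik⟩) B where
  e := parEquiv A i k hik B D
  f := fun x => match x with
    | Sum.inl ⟨Sum.inl a, _⟩ => 𝟙 (A.col a.1)
    | Sum.inl ⟨Sum.inr b, _⟩ => 𝟙 (B.col b)
    | Sum.inr d => 𝟙 (D.col d)

/-- The three inputs of `μ ∘₁ μ`, read as `(12)3`, matched with those of `μ ∘₂ μ`, read as `1(23)`
(the two inputs of `μ` are `0, 1 : Fin 2`). -/
def ternaryEquiv : ({a : Fin 2 // a ≠ 0} ⊕ Fin 2) ≃ ({a : Fin 2 // a ≠ 1} ⊕ Fin 2) where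
  toFun := fun x => match x with
    | Sum.inr 0 => Sum.inl ⟨0, by decide⟩
    | Sum.inr 1 => Sum.inr 0
    | Sum.inl _ => Sum.inr 1
  invFun := fun x => match x with
    | Sum.inl _ => Sum.inr 0
    | Sum.inr 0 => Sum.inr 1
    | Sum.inr 1 => Sum.inl ⟨1, by decide⟩
  left_inv := by decide
  right_inv := by decide

/-- The bijection `ternaryEquiv` as an isomorphism of profiles of constant colour. -/
def ternaryHom (a : V) :
    (const (Fin 2) a).subst (0 : Fin 2) (const (Fin 2) a) ⟶
      (const (Fin 2) a).subst (1 : Fin 2) (const (Fin 2) a) where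
  e := ternaryEquiv
  f := fun x => match x with
    | Sum.inr 0 => 𝟙 a
    | Sum.inr 1 => 𝟙 a
    | Sum.inl _ => 𝟙 a

end

/-- The image of a profile under a morphism of groupoids. -/
abbrev map {U : Type u} {V : Type w} [Category.{v} U] [Category.{x} V] (F : U ⥤ V) (A : Arity U) :
    Arity V where
  ι := A.ι
  col := fun i => F.obj (A.col i)

/-- The image of a morphism of profiles under a morphism of groupoids. -/
def mapHom {U : Type u} {V : Type w} [Category.{v} U] [Category.{x} V] (F : U ⥤ V)
    {A B : Arity U} (g : A ⟶ B) : A.map F ⟶ B.map F :=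
  ⟨g.e, fun i => F.map (g.f i)⟩

/-- The canonical identification of `F (A ∘ᵢ B)` with `F A ∘ᵢ F B`. -/
def mapSubst {U : Type u} {V : Type w} [Category.{v} U] [Category.{x} V] (F : U ⥤ V)
    (A : Arity U) (i : A.ι) (B : Arity U) :
    (A.subst i B).map F ⟶ (A.map F).subst i (B.map F) where
  e := Equiv.refl _
  f := fun x => match x with
    | Sum.inl a => 𝟙 (F.obj (A.col a.1))
    | Sum.inr b => 𝟙 (F.obj (B.col b))

end Arity

/-! ### Groupoid coloured operads -/

/-- A symmetric, reduced, non-unital operad in `K`-vector spaces coloured by the groupoid `V`: a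
functor `P(A; d)`, contravariant in the input profile `A` and covariant in the output colour `d`,
with partial compositions `∘ᵢ` that are natural (including compatibility with the groupoid on the
internal edge) and satisfy the sequential and the parallel associativity law. -/
structure GOperad (K : Type x) [Field K] (V : Type u) [Groupoid.{v} V] where
  obj : Arity V → V → Type w
  [grp : ∀ A d, AddCommGroup (obj A d)]
  [mod : ∀ A d, Module K (obj A d)]
  act : ∀ {A' A : Arity V} {d d' : V}, (A' ⟶ A) → (d ⟶ d') → obj A d →ₗ[K] obj A' d'
  comp : ∀ {A B : Arity V} {d : V} (i : A.ι),
    obj A d →ₗ[K] obj B (A.col i) →ₗ[K] obj (A.subst i B) d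
  act_id : ∀ {A : Arity V} {d : V} (α : obj A d), act (𝟙 A) (𝟙 d) α = α
  act_act : ∀ {A'' A' A : Arity V} {d d' d'' : V} (g' : A'' ⟶ A') (g : A' ⟶ A) (f : d ⟶ d')
    (f' : d' ⟶ d'') (α : obj A d), act g' f' (act g f α) = act (g' ≫ g) (f ≫ f') α
  comp_act : ∀ {A' A B' B : Arity V} {d d' : V} (g : A' ⟶ A) (f : d ⟶ d') (i : A'.ι) (h : B' ⟶ B)
    (α : obj A d) (β : obj B (A'.col i)),
    comp i (act g f α) (act h (𝟙 _) β) =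
      act (Arity.substHom g i h) f (comp (g.e i) α (act (𝟙 B) (g.f i) β))
  comp_seq : ∀ {A B D : Arity V} {d : V} (i : A.ι) (j : B.ι)
    (α : obj A d) (β : obj B (A.col i)) (γ : obj D (B.col j)),
    comp (A := A.subst i B) (Sum.inr j) (comp i α β) γ =
      act (Arity.seqHom A i B j D) (𝟙 d) (comp i α (comp j β γ))
  comp_par : ∀ {A B D : Arity V} {d : V} (i k : A.ι) (hik : i ≠ k)
    (α : obj A d) (β : obj B (A.col i)) (γ : obj D (A.col k)),
    comp (A := A.subst i B) (Sum.inl ⟨k, hik.symm⟩) (comp i α β) γ =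
      act (Arity.parHom A i k hik B D) (𝟙 d)
        (comp (A := A.subst k D) (Sum.inl ⟨i, hik⟩) (comp k α γ) β)

attribute [instance] GOperad.grp GOperad.mod

namespace GOperad

variable {K : Type x} [Field K]

/-- A morphism of groupoid coloured operads whose morphism of groupoids of colours is `functor`. -/
structure Hom {U : Type*} [Groupoid U] {V : Type*} [Groupoid V] (functor : U ⥤ V)
    (P : GOperad K U) (Q : GOperad K V) where
  app : ∀ (A : Arity U) (d : U), P.obj A d →ₗ[K] Q.obj (A.map functor) (functor.obj d)
  app_act : ∀ {A' A : Arity U} {d d' : U} (g : A' ⟶ A) (f : d ⟶ d') (α : P.obj A d),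
    app A' d' (P.act g f α) = Q.act (Arity.mapHom functor g) (functor.map f) (app A d α)
  app_comp : ∀ {A B : Arity U} {d : U} (i : A.ι) (α : P.obj A d) (β : P.obj B (A.col i)),
    app (A.subst i B) d (P.comp i α β) =
      Q.act (Arity.mapSubst functor A i B) (𝟙 _)
        (Q.comp (A := A.map functor) i (app A d α) (app B (A.col i) β))

/-- A suboperad: a family of subspaces closed under the groupoid actions and compositions. -/
structure Suboperad {V : Type*} [Groupoid V] (P : GOperad K V) where
  carrier : ∀ (A : Arity V) (d : V), Submodule K (P.obj A d)
  act_mem : ∀ {A' A : Arity V} {d d' : V} (g : A' ⟶ A) (f : d ⟶ d') {α : P.obj A d},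
    α ∈ carrier A d → P.act g f α ∈ carrier A' d'
  comp_mem : ∀ {A B : Arity V} {d : V} (i : A.ι) {α : P.obj A d} {β : P.obj B (A.col i)},
    α ∈ carrier A d → β ∈ carrier B (A.col i) → P.comp i α β ∈ carrier (A.subst i B) d

/-- The suboperad generated by one operation: the smallest suboperad containing it. -/
def adjoin {V : Type*} [Groupoid V] (P : GOperad K V) {A₀ : Arity V} {d₀ : V}
    (η : P.obj A₀ d₀) : P.Suboperad where
  carrier A d := ⨅ S : {S : P.Suboperad // η ∈ S.carrier A₀ d₀}, S.1.carrier A d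
  act_mem g f α hα := by
    rw [Submodule.mem_iInf] at hα ⊢
    exact fun S => S.1.act_mem g f (hα S)
  comp_mem i α β hα hβ := by
    rw [Submodule.mem_iInf] at hα hβ ⊢
    exact fun S => S.1.comp_mem i (hα S) (hβ S)

/-- The morphism `φ : P → Q` is an isomorphism of `P` onto the suboperad `S` of `Q`, where `S` is
coloured by a full subgroupoid of the colours of `Q`: on colours, `φ` is an isomorphism onto a full
subgroupoid, every component of `φ` is injective with image the corresponding component of `S`, and
`S` has no nonzero operation involving a colour outside of that subgroupoid. -/
structure Hom.IsIsoOnto {U : Type*} [Groupoid U] {V : Type*} [Groupoid V]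
    {P : GOperad K U} {Q : GOperad K V} {F : U ⥤ V} (φ : Hom F P Q) (S : Q.Suboperad) : Prop where
  full : F.Full
  faithful : F.Faithful
  obj_injective : Function.Injective F.obj
  app_injective : ∀ A d, Function.Injective (φ.app A d)
  range_eq : ∀ A d, LinearMap.range (φ.app A d) = S.carrier (A.map F) (F.obj d)
  support : ∀ A d, S.carrier A d ≠ ⊥ →
    (∀ i, A.col i ∈ Set.range F.obj) ∧ d ∈ Set.range F.obj

end GOperad

/-! ### Operads given by generators and relations -/

/-- A groupoid coloured module with a basis permuted by the groupoid; `obj A d` is the basis. -/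
structure GenModule (V : Type u) [Groupoid.{v} V] where
  obj : Arity V → V → Type w
  act : ∀ {A' A : Arity V} {d d' : V}, (A' ⟶ A) → (d ⟶ d') → obj A d → obj A' d'
  act_id : ∀ {A : Arity V} {d : V} (e : obj A d), act (𝟙 A) (𝟙 d) e = e
  act_act : ∀ {A'' A' A : Arity V} {d d' d'' : V} (g' : A'' ⟶ A') (g : A' ⟶ A) (f : d ⟶ d')
    (f' : d' ⟶ d'') (e : obj A d), act g' f' (act g f e) = act (g' ≫ g) (f ≫ f') e

/-- Formal operadic expressions in the generators `E`. -/
inductive Raw (K : Type x) {V : Type u} [Groupoid.{v} V] (E : GenModule.{u, v, w} V) :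
    Arity V → V → Type (max 1 u v w x)
  | gen {A : Arity V} {d : V} (e : E.obj A d) : Raw K E A d
  | zero {A : Arity V} {d : V} : Raw K E A d
  | add {A : Arity V} {d : V} (s t : Raw K E A d) : Raw K E A d
  | smul {A : Arity V} {d : V} (k : K) (t : Raw K E A d) : Raw K E A d
  | act {A' A : Arity V} {d d' : V} (g : A' ⟶ A) (f : d ⟶ d') (t : Raw K E A d) : Raw K E A' d'
  | comp {A B : Arity V} {d : V} (i : A.ι) (s : Raw K E A d) (t : Raw K E B (A.col i)) :
      Raw K E (A.subst i B) d

namespace Raw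

variable {K : Type x} [Field K] {V : Type u} [Groupoid.{v} V] {E : GenModule.{u, v, w} V}

/-- The congruence on expressions generated by the axioms of a `K`-linear groupoid coloured operad,
the module structure of `E`, and the given relations `R`. -/
inductive Rel (R : ∀ (A : Arity V) (d : V), Raw K E A d → Raw K E A d → Prop) :
    ∀ {A : Arity V} {d : V}, Raw K E A d → Raw K E A d → Prop
  | refl {A : Arity V} {d : V} (s : Raw K E A d) : Rel R s s
  | symm {A : Arity V} {d : V} {s t : Raw K E A d} : Rel R s t → Rel R t s
  | trans {A : Arity V} {d : V} {r s t : Raw K E A d} : Rel R r s → Rel R s t → Rel R r t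
  | add_congr {A : Arity V} {d : V} {s s' t t' : Raw K E A d} :
      Rel R s s' → Rel R t t' → Rel R (add s t) (add s' t')
  | smul_congr {A : Arity V} {d : V} (k : K) {s s' : Raw K E A d} :
      Rel R s s' → Rel R (smul k s) (smul k s')
  | act_congr {A' A : Arity V} {d d' : V} (g : A' ⟶ A) (f : d ⟶ d') {s s' : Raw K E A d} :
      Rel R s s' → Rel R (act g f s) (act g f s')
  | comp_congr {A B : Arity V} {d : V} (i : A.ι) {s s' : Raw K E A d}
      {t t' : Raw K E B (A.col i)} :
      Rel R s s' → Rel R t t' → Rel R (comp i s t) (comp i s' t')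
  | zero_add {A : Arity V} {d : V} (s : Raw K E A d) : Rel R (add zero s) s
  | add_comm {A : Arity V} {d : V} (s t : Raw K E A d) : Rel R (add s t) (add t s)
  | add_assoc {A : Arity V} {d : V} (r s t : Raw K E A d) :
      Rel R (add (add r s) t) (add r (add s t))
  | zero_smul {A : Arity V} {d : V} (s : Raw K E A d) : Rel R (smul 0 s) zero
  | one_smul {A : Arity V} {d : V} (s : Raw K E A d) : Rel R (smul 1 s) s
  | mul_smul {A : Arity V} {d : V} (k l : K) (s : Raw K E A d) :
      Rel R (smul (k * l) s) (smul k (smul l s))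
  | smul_add {A : Arity V} {d : V} (k : K) (s t : Raw K E A d) :
      Rel R (smul k (add s t)) (add (smul k s) (smul k t))
  | add_smul {A : Arity V} {d : V} (k l : K) (s : Raw K E A d) :
      Rel R (smul (k + l) s) (add (smul k s) (smul l s))
  | act_add {A' A : Arity V} {d d' : V} (g : A' ⟶ A) (f : d ⟶ d') (s t : Raw K E A d) :
      Rel R (act g f (add s t)) (add (act g f s) (act g f t))
  | act_smul {A' A : Arity V} {d d' : V} (g : A' ⟶ A) (f : d ⟶ d') (k : K) (s : Raw K E A d) :
      Rel R (act g f (smul k s)) (smul k (act g f s))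
  | comp_add_left {A B : Arity V} {d : V} (i : A.ι) (s s' : Raw K E A d)
      (t : Raw K E B (A.col i)) :
      Rel R (comp i (add s s') t) (add (comp i s t) (comp i s' t))
  | comp_smul_left {A B : Arity V} {d : V} (i : A.ι) (k : K) (s : Raw K E A d)
      (t : Raw K E B (A.col i)) : Rel R (comp i (smul k s) t) (smul k (comp i s t))
  | comp_add_right {A B : Arity V} {d : V} (i : A.ι) (s : Raw K E A d)
      (t t' : Raw K E B (A.col i)) :
      Rel R (comp i s (add t t')) (add (comp i s t) (comp i s t'))
  | comp_smul_right {A B : Arity V} {d : V} (i : A.ι) (k : K) (s : Raw K E A d)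
      (t : Raw K E B (A.col i)) : Rel R (comp i s (smul k t)) (smul k (comp i s t))
  | act_id {A : Arity V} {d : V} (s : Raw K E A d) : Rel R (act (𝟙 A) (𝟙 d) s) s
  | act_act {A'' A' A : Arity V} {d d' d'' : V} (g' : A'' ⟶ A') (g : A' ⟶ A) (f : d ⟶ d')
      (f' : d' ⟶ d'') (s : Raw K E A d) :
      Rel R (act g' f' (act g f s)) (act (g' ≫ g) (f ≫ f') s)
  | comp_act {A' A B' B : Arity V} {d d' : V} (g : A' ⟶ A) (f : d ⟶ d') (i : A'.ι) (h : B' ⟶ B)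
      (s : Raw K E A d) (t : Raw K E B (A'.col i)) :
      Rel R (comp i (act g f s) (act h (𝟙 _) t))
        (act (Arity.substHom g i h) f (comp (g.e i) s (act (𝟙 B) (g.f i) t)))
  | comp_seq {A B D : Arity V} {d : V} (i : A.ι) (j : B.ι)
      (r : Raw K E A d) (s : Raw K E B (A.col i)) (t : Raw K E D (B.col j)) :
      Rel R (comp (A := A.subst i B) (Sum.inr j) (comp i r s) t)
        (act (Arity.seqHom A i B j D) (𝟙 d) (comp i r (comp j s t)))
  | comp_par {A B D : Arity V} {d : V} (i k : A.ι) (hik : i ≠ k)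
      (r : Raw K E A d) (s : Raw K E B (A.col i)) (t : Raw K E D (A.col k)) :
      Rel R (comp (A := A.subst i B) (Sum.inl ⟨k, hik.symm⟩) (comp i r s) t)
        (act (Arity.parHom A i k hik B D) (𝟙 d)
          (comp (A := A.subst k D) (Sum.inl ⟨i, hik⟩) (comp k r t) s))
  | gen_act {A' A : Arity V} {d d' : V} (g : A' ⟶ A) (f : d ⟶ d') (e : E.obj A d) :
      Rel R (act g f (gen e)) (gen (E.act g f e))
  | rel {A : Arity V} {d : V} {s t : Raw K E A d} : R A d s t → Rel R s t

/-- The setoid of the congruence. -/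
def setoid (R : ∀ (A : Arity V) (d : V), Raw K E A d → Raw K E A d → Prop)
    (A : Arity V) (d : V) : Setoid (Raw K E A d) where
  r := Rel R
  iseqv := ⟨Rel.refl, Rel.symm, Rel.trans⟩

/-- The component `(F(E)/⟨R⟩)(A; d)`. -/
def Presented (R : ∀ (A : Arity V) (d : V), Raw K E A d → Raw K E A d → Prop)
    (A : Arity V) (d : V) : Type (max 1 u v w x) :=
  Quotient (setoid R A d)

variable (R : ∀ (A : Arity V) (d : V), Raw K E A d → Raw K E A d → Prop)

instance (A : Arity V) (d : V) : Zero (Presented R A d) :=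
  ⟨Quotient.mk _ zero⟩

instance (A : Arity V) (d : V) : Add (Presented R A d) :=
  ⟨Quotient.map₂ add (fun _ _ h _ _ h' => Rel.add_congr h h')⟩

instance (A : Arity V) (d : V) : Neg (Presented R A d) :=
  ⟨Quotient.map (smul (-1)) (fun _ _ h => Rel.smul_congr _ h)⟩

instance (A : Arity V) (d : V) : AddCommGroup (Presented R A d) where
  nsmul := nsmulRec
  zsmul := zsmulRec
  add_assoc := by
    rintro ⟨a⟩ ⟨b⟩ ⟨c⟩
    exact Quotient.sound (Rel.add_assoc a b c)
  zero_add := by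
    rintro ⟨a⟩
    exact Quotient.sound (Rel.zero_add a)
  add_zero := by
    rintro ⟨a⟩
    exact Quotient.sound ((Rel.add_comm a zero).trans (Rel.zero_add a))
  add_comm := by
    rintro ⟨a⟩ ⟨b⟩
    exact Quotient.sound (Rel.add_comm a b)
  neg_add_cancel := by
    rintro ⟨a⟩
    refine Quotient.sound (?_ : Rel R (add (smul (-1) a) a) zero)
    refine (Rel.add_congr (Rel.refl _) (Rel.one_smul a).symm).trans ?_
    refine (Rel.add_smul (-1) 1 a).symm.trans ?_
    rw [neg_add_cancel]
    exact Rel.zero_smul a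

instance (A : Arity V) (d : V) : Module K (Presented R A d) :=
  letI : SMul K (Presented R A d) :=
    ⟨fun k => Quotient.map (smul k) (fun _ _ h => Rel.smul_congr k h)⟩
  Module.ofMinimalAxioms
    (by rintro k ⟨a⟩ ⟨b⟩; exact Quotient.sound (Rel.smul_add k a b))
    (by rintro k l ⟨a⟩; exact Quotient.sound (Rel.add_smul k l a))
    (by rintro k l ⟨a⟩; exact Quotient.sound (Rel.mul_smul k l a))
    (by rintro ⟨a⟩; exact Quotient.sound (Rel.one_smul a))

end Raw

/-- The operad `F(E)/⟨R⟩` presented by the generators `E` and the relations `s = t` for `R s t`. -/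
def GOperad.presented (K : Type x) [Field K] {V : Type u} [Groupoid.{v} V]
    (E : GenModule.{u, v, w} V)
    (R : ∀ (A : Arity V) (d : V), Raw K E A d → Raw K E A d → Prop) :
    GOperad.{u, v, max 1 u v w x, x} K V where
  obj := Raw.Presented R
  act g f :=
    { toFun := Quotient.map (Raw.act g f) (fun _ _ h => Raw.Rel.act_congr g f h)
      map_add' := by
        rintro ⟨a⟩ ⟨b⟩
        exact Quotient.sound (Raw.Rel.act_add g f a b)
      map_smul' := by
        rintro k ⟨a⟩
        exact Quotient.sound (Raw.Rel.act_smul g f k a) }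
  comp i := LinearMap.mk₂ K
    (Quotient.map₂ (Raw.comp i) (fun _ _ h _ _ h' => Raw.Rel.comp_congr i h h'))
    (by rintro ⟨a⟩ ⟨b⟩ ⟨c⟩; exact Quotient.sound (Raw.Rel.comp_add_left i a b c))
    (by rintro k ⟨a⟩ ⟨b⟩; exact Quotient.sound (Raw.Rel.comp_smul_left i k a b))
    (by rintro ⟨a⟩ ⟨b⟩ ⟨c⟩; exact Quotient.sound (Raw.Rel.comp_add_right i a b c))
    (by rintro k ⟨a⟩ ⟨b⟩; exact Quotient.sound (Raw.Rel.comp_smul_right i k a b))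
  act_id := by
    rintro A d ⟨a⟩
    exact Quotient.sound (Raw.Rel.act_id a)
  act_act := by
    rintro A'' A' A d d' d'' g' g f f' ⟨a⟩
    exact Quotient.sound (Raw.Rel.act_act g' g f f' a)
  comp_act := by
    rintro A' A B' B d d' g f i h ⟨a⟩ ⟨b⟩
    exact Quotient.sound (Raw.Rel.comp_act g f i h a b)
  comp_seq := by
    rintro A B D d i j ⟨a⟩ ⟨b⟩ ⟨c⟩
    exact Quotient.sound (Raw.Rel.comp_seq i j a b c)
  comp_par := by
    rintro A B D d i k hik ⟨a⟩ ⟨b⟩ ⟨c⟩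
    exact Quotient.sound (Raw.Rel.comp_par i k hik a b c)

/-- The class of a generator in the presented operad. -/
def GOperad.presentedGen (K : Type x) [Field K] {V : Type u} [Groupoid.{v} V]
    {E : GenModule.{u, v, w} V}
    (R : ∀ (A : Arity V) (d : V), Raw K E A d → Raw K E A d → Prop)
    {A : Arity V} {d : V} (e : E.obj A d) : (GOperad.presented K E R).obj A d :=
  Quotient.mk (Raw.setoid R A d) (Raw.gen e)

/-! ### The commutative operad -/

/-- The discrete groupoid with one object. -/
abbrev OneObj : Type := Discrete PUnit.{1}

/-- The only object. -/
abbrev OneObj.star : OneObj := ⟨PUnit.unit⟩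

/-- The component of the (non-unital) commutative operad in arity `A`: the trivial representation
`K` if there are at least two inputs, and `0` otherwise. -/
def comObj (K : Type x) [Field K] (A : Arity OneObj) : Submodule K K where
  carrier := {k | 2 ≤ Nat.card A.ι ∨ k = 0}
  add_mem' := by
    rintro a b (h | rfl) (h' | rfl)
    · exact Or.inl h
    · exact Or.inl h
    · exact Or.inl h'
    · exact Or.inr (add_zero 0)
  zero_mem' := Or.inr rfl
  smul_mem' := by
    rintro c a (h | rfl)
    · exact Or.inl h
    · exact Or.inr (smul_zero c)

theorem comObj_comp_mem {K : Type x} [Field K] {A B : Arity OneObj} (i : A.ι) {a b : K}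
    (ha : a ∈ comObj K A) (hb : b ∈ comObj K B) : a * b ∈ comObj K (A.subst i B) := by
  rcases ha with ha | rfl
  · rcases hb with hb | rfl
    · refine Or.inl (hb.trans ?_)
      change Nat.card B.ι ≤ Nat.card ({a : A.ι // a ≠ i} ⊕ B.ι)
      rw [Nat.card_sum]
      exact Nat.le_add_left _ _
    · exact Or.inr (mul_zero a)
  · exact Or.inr (zero_mul b)

/-- The commutative operad, as a non-unital operad with one colour: `Com(n) = K` with trivial action
of `Σₙ` for `n ≥ 2`, and composition the multiplication of scalars. -/
def Com (K : Type x) [Field K] : GOperad K OneObj where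
  obj A _ := comObj K A
  act {A' A _ _} g _ := (LinearMap.id (R := K) (M := K)).restrict
    (p := comObj K A) (q := comObj K A')
    (fun _ hk => hk.imp (fun h => h.trans_eq (Nat.card_congr g.e).symm) id)
  comp i := LinearMap.mk₂ K (fun a b => ⟨a.1 * b.1, comObj_comp_mem i a.2 b.2⟩)
    (fun a b c => Subtype.ext (add_mul a.1 b.1 c.1))
    (fun k a b => Subtype.ext (mul_assoc k a.1 b.1))
    (fun a b c => Subtype.ext (mul_add a.1 b.1 c.1))
    (fun k a b => Subtype.ext (mul_left_comm a.1 k b.1))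
  act_id _ := rfl
  act_act _ _ _ _ _ := rfl
  comp_act _ _ _ _ _ _ := rfl
  comp_seq _ _ a b c := Subtype.ext (mul_assoc a.1 b.1 c.1)
  comp_par _ _ _ a b c := Subtype.ext (mul_right_comm a.1 b.1 c.1)

/-- The commutative product in `Com(2)`. -/
def Com.mu (K : Type x) [Field K] : (Com K).obj (Arity.const (Fin 2) OneObj.star) OneObj.star :=
  ⟨1, Or.inl (by simp)⟩

/-- The module with one binary generator and trivial action of `Σ₂`. -/
def binaryGen : GenModule OneObj where
  obj A _ := PLift (Nat.card A.ι = 2)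
  act g _ e := ⟨(Nat.card_congr g.e).trans e.down⟩
  act_id _ := rfl
  act_act _ _ _ _ _ := rfl

/-- The binary generator, on two labelled inputs. -/
def binaryGen.mu : binaryGen.obj (Arity.const (Fin 2) OneObj.star) OneObj.star :=
  ⟨by simp⟩

/-- The single relation `μ(μ(1,2),3) = μ(1,μ(2,3))`. -/
inductive AssocRel (K : Type x) :
    ∀ (A : Arity OneObj) (d : OneObj), Raw K binaryGen A d → Raw K binaryGen A d → Prop
  | assoc : AssocRel K _ _
      (Raw.comp (A := Arity.const (Fin 2) OneObj.star) (0 : Fin 2)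
        (Raw.gen binaryGen.mu) (Raw.gen binaryGen.mu))
      (Raw.act (Arity.ternaryHom OneObj.star) (𝟙 _)
        (Raw.comp (A := Arity.const (Fin 2) OneObj.star) (1 : Fin 2)
          (Raw.gen binaryGen.mu) (Raw.gen binaryGen.mu)))

/-- The operad with one commutative binary generator subject only to associativity. -/
abbrev ComPresented (K : Type x) [Field K] : GOperad K OneObj :=
  GOperad.presented K binaryGen (AssocRel K)

/-! ### The groupoid of pairs of colour profiles -/

/-- The groupoid `𝒫(C)`: finite sequences of colours, with a morphism `c ⟶ d` for each permutation
`σ` with `d = σ c = (c_{σ(1)}, …, c_{σ(n)})`. -/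
def Profile (C : Type u) : Type u := List C

instance (C : Type u) : Groupoid (Profile C) where
  Hom c d := {σ : Fin (List.length d) ≃ Fin (List.length c) //
    ∀ k, List.get d k = List.get c (σ k)}
  id _ := ⟨Equiv.refl _, fun _ => rfl⟩
  comp σ τ := ⟨τ.1.trans σ.1, fun k => (τ.2 k).trans (σ.2 (τ.1 k))⟩
  inv {c d} σ := ⟨σ.1.symm, fun k => by rw [σ.2 (σ.1.symm k), Equiv.apply_symm_apply]⟩
  id_comp _ := rfl
  comp_id _ := rfl
  assoc _ _ _ := rfl
  inv_comp σ := Subtype.ext (Equiv.self_trans_symm σ.1)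
  comp_inv σ := Subtype.ext (Equiv.symm_trans_self σ.1)

instance (C : Type u) : Groupoid (Profile C)ᵒᵖ where
  inv f := (Groupoid.inv f.unop).op
  inv_comp f := Quiver.Hom.unop_inj (Groupoid.comp_inv f.unop)
  comp_inv f := Quiver.Hom.unop_inj (Groupoid.inv_comp f.unop)

/-- The groupoid `𝒮(C) = 𝒫(C)ᵒᵖ × 𝒫(C)`; an object is a pair (input profile, output profile). -/
abbrev BiProfile (C : Type u) : Type u := (Profile C)ᵒᵖ × Profile C

namespace BiProfile

variable {C : Type u}

/-- The object with empty input and empty output profile. -/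
def empty (C : Type u) : BiProfile C := (Opposite.op ([] : List C), ([] : List C))

/-- The positions of the input profile. -/
abbrev In (p : BiProfile C) : Type := Fin (List.length p.1.unop)

/-- The positions of the output profile. -/
abbrev Out (p : BiProfile C) : Type := Fin (List.length p.2)

/-- The colour of an input. -/
def inCol (p : BiProfile C) (k : p.In) : C := List.get p.1.unop k

/-- The colour of an output. -/
def outCol (p : BiProfile C) (k : p.Out) : C := List.get p.2 k

/-- The bijection of inputs underlying a morphism of `𝒮(C)`. -/
def inEquiv {p q : BiProfile C} (g : p ⟶ q) : p.In ≃ q.In := g.1.unop.1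

/-- The bijection of outputs underlying a morphism of `𝒮(C)`. -/
def outEquiv {p q : BiProfile C} (g : p ⟶ q) : p.Out ≃ q.Out := g.2.1.symm

theorem inCol_inEquiv {p q : BiProfile C} (g : p ⟶ q) (k : p.In) :
    q.inCol (inEquiv g k) = p.inCol k := (g.1.unop.2 k).symm

theorem outCol_outEquiv {p q : BiProfile C} (g : p ⟶ q) (k : p.Out) :
    q.outCol (outEquiv g k) = p.outCol k :=
  (g.2.2 (g.2.1.symm k)).trans (by rw [Equiv.apply_symm_apply]; rfl)

end BiProfile

/-! ### Graphs -/

section Graphs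

variable {C : Type u}

/-- All inputs of a family of vertices with profiles `A`. -/
abbrev VIn (A : Arity (BiProfile C)) : Type := Σ i : A.ι, (A.col i).In

/-- All outputs of a family of vertices with profiles `A`. -/
abbrev VOut (A : Arity (BiProfile C)) : Type := Σ i : A.ι, (A.col i).Out

/-- The effect of a morphism of profiles on the inputs of the vertices. -/
def vInEquiv {A B : Arity (BiProfile C)} (g : A ⟶ B) : VIn A ≃ VIn B :=
  Equiv.sigmaCongr g.e (fun i => BiProfile.inEquiv (g.f i))

/-- The effect of a morphism of profiles on the outputs of the vertices. -/
def vOutEquiv {A B : Arity (BiProfile C)} (g : A ⟶ B) : VOut A ≃ VOut B :=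
  Equiv.sigmaCongr g.e (fun i => BiProfile.outEquiv (g.f i))

/-- The wires of a directed graph with labelled vertices whose vertices have the profiles `A`, and
which itself has the profile `d`.  Each output of a vertex is either joined to an input of a vertex
(an internal edge) or is an output of the graph, and each input of the graph is an input of a
vertex. -/
@[ext]
structure Wiring (A : Arity (BiProfile C)) (d : BiProfile C) where
  out : VOut A → VIn A ⊕ d.Out
  inp : d.In → VIn A

namespace Wiring

/-- The wires form a `C`-coloured graph: each input of a vertex and each output of the graph is
reached exactly once, and the wires preserve the colours. -/
structure IsGraph {A : Arity (BiProfile C)} {d : BiProfile C} (G : Wiring A d) : Prop where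
  bijective : Function.Bijective (Sum.elim G.out (fun k => Sum.inl (G.inp k)))
  edge_col : ∀ y z, G.out y = Sum.inl z → (A.col y.1).outCol y.2 = (A.col z.1).inCol z.2
  out_col : ∀ y k, G.out y = Sum.inr k → (A.col y.1).outCol y.2 = d.outCol k
  inp_col : ∀ k, d.inCol k = (A.col (G.inp k).1).inCol (G.inp k).2

/-- Two vertices and no internal edges.  For two vertices with profiles `(c; d)` and `(a; b)` these
are the generators `(⊗ₕ, σ, τ)`: the permutations `σ`, `τ` match the outputs of the graph with the
sequence `(d, b)`, and the inputs with the sequence `(c, a)`. -/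
def IsHorizontal {A : Arity (BiProfile C)} {d : BiProfile C} (G : Wiring A d) : Prop :=
  Nat.card A.ι = 2 ∧ ∀ y z, G.out y ≠ Sum.inl z

/-- One vertex and one internal edge (a loop): the contractions `(ξⱼⁱ, σ, τ)`, where the loop joins
the output `i` to the input `j`. -/
def IsContraction {A : Arity (BiProfile C)} {d : BiProfile C} (G : Wiring A d) : Prop :=
  Nat.card A.ι = 1 ∧ ∃! y, ∃ z, G.out y = Sum.inl z

/-- Two vertices and at least one internal edge, where all internal edges go from one of the vertices
to the other one: the properadic compositions `∘ᵥ` and the opposite ones (which vertex is on top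
distinguishes the two). -/
def IsProperadic {A : Arity (BiProfile C)} {d : BiProfile C} (G : Wiring A d) : Prop :=
  Nat.card A.ι = 2 ∧ (∃ y z, G.out y = Sum.inl z) ∧
    ∃ top bot : A.ι, top ≠ bot ∧ ∀ y z, G.out y = Sum.inl z → y.1 = bot ∧ z.1 = top

/-- Relabelling of the vertices and of the inputs and outputs of the vertices and of the graph. -/
def act {A' A : Arity (BiProfile C)} {d d' : BiProfile C} (g : A' ⟶ A) (f : d ⟶ d')
    (G : Wiring A d) : Wiring A' d' where
  out y := Sum.map (vInEquiv g).symm (BiProfile.outEquiv f) (G.out (vOutEquiv g y))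
  inp k := (vInEquiv g).symm (G.inp ((BiProfile.inEquiv f).symm k))

open Classical in
/-- The target in the composite graph of a wire that ends in an input of a vertex of the outer graph;
if that vertex is the one replaced by `H`, the wire is continued in `H`. -/
noncomputable def push {A B : Arity (BiProfile C)} (i : A.ι) (H : Wiring B (A.col i)) (z : VIn A) :
    VIn (A.subst i B) :=
  if h : z.1 = i then
    ⟨Sum.inr (H.inp (h ▸ z.2)).1, (H.inp (h ▸ z.2)).2⟩
  else ⟨Sum.inl ⟨z.1, h⟩, z.2⟩

/-- Graph substitution: the vertex `i` of `G` is replaced by the graph `H`. -/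
noncomputable def comp {A B : Arity (BiProfile C)} {d : BiProfile C} (i : A.ι) (G : Wiring A d)
    (H : Wiring B (A.col i)) : Wiring (A.subst i B) d where
  out := fun y => match y with
    | ⟨Sum.inl a, y⟩ => Sum.map (push i H) id (G.out ⟨a.1, y⟩)
    | ⟨Sum.inr b, y⟩ => Sum.elim (fun z => Sum.inl ⟨Sum.inr z.1, z.2⟩)
        (fun k => Sum.map (push i H) id (G.out ⟨i, k⟩)) (H.out ⟨b, y⟩)
  inp := fun k => push i H (G.inp k)

theorem act_id {A : Arity (BiProfile C)} {d : BiProfile C} (G : Wiring A d) :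
    act (𝟙 A) (𝟙 d) G = G := by
  refine Wiring.ext (funext fun y => ?_) rfl
  change Sum.map id id (G.out y) = G.out y
  rw [Sum.map_id_id, id]

theorem act_act {A'' A' A : Arity (BiProfile C)} {d d' d'' : BiProfile C} (g' : A'' ⟶ A')
    (g : A' ⟶ A) (f : d ⟶ d') (f' : d' ⟶ d'') (G : Wiring A d) :
    act g' f' (act g f G) = act (g' ≫ g) (f ≫ f') G := by
  have hin : ∀ z, (vInEquiv (g' ≫ g)).symm z = (vInEquiv g').symm ((vInEquiv g).symm z) := by
    intro z
    rw [Equiv.symm_apply_eq]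
    change z = vInEquiv g (vInEquiv g' _)
    rw [Equiv.apply_symm_apply, Equiv.apply_symm_apply]
  refine Wiring.ext (funext fun y => ?_) (funext fun k => ?_)
  · change Sum.map _ _ (Sum.map _ _ (G.out (vOutEquiv g (vOutEquiv g' y)))) =
      Sum.map _ _ (G.out (vOutEquiv g (vOutEquiv g' y)))
    rw [Sum.map_map]
    cases G.out (vOutEquiv g (vOutEquiv g' y)) with
    | inl z => exact congrArg Sum.inl (hin z).symm
    | inr k => rfl
  · exact (hin _).symm

theorem act_out_inl {A' A : Arity (BiProfile C)} {d d' : BiProfile C} (g : A' ⟶ A) (f : d ⟶ d')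
    (G : Wiring A d) (y : VOut A') (z : VIn A') :
    (act g f G).out y = Sum.inl z ↔ G.out (vOutEquiv g y) = Sum.inl (vInEquiv g z) := by
  change Sum.map _ _ (G.out (vOutEquiv g y)) = _ ↔ _
  cases G.out (vOutEquiv g y) with
  | inl z' => simp [Equiv.symm_apply_eq]
  | inr k => simp

theorem inCol_vInEquiv {A' A : Arity (BiProfile C)} (g : A' ⟶ A) (z : VIn A') :
    (A.col (vInEquiv g z).1).inCol (vInEquiv g z).2 = (A'.col z.1).inCol z.2 :=
  BiProfile.inCol_inEquiv (g.f z.1) z.2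

theorem outCol_vOutEquiv {A' A : Arity (BiProfile C)} (g : A' ⟶ A) (y : VOut A') :
    (A.col (vOutEquiv g y).1).outCol (vOutEquiv g y).2 = (A'.col y.1).outCol y.2 :=
  BiProfile.outCol_outEquiv (g.f y.1) y.2

theorem IsGraph.act {A' A : Arity (BiProfile C)} {d d' : BiProfile C} (g : A' ⟶ A) (f : d ⟶ d')
    {G : Wiring A d} (hG : G.IsGraph) : (Wiring.act g f G).IsGraph where
  bijective := by
    have h : Sum.elim (Wiring.act g f G).out (fun k => Sum.inl ((Wiring.act g f G).inp k)) =
        (Equiv.sumCongr (vInEquiv g).symm (BiProfile.outEquiv f)) ∘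
          (Sum.elim G.out (fun k => Sum.inl (G.inp k))) ∘
            (Equiv.sumCongr (vOutEquiv g) (BiProfile.inEquiv f).symm) := by
      funext x
      cases x <;> rfl
    rw [h]
    exact (Equiv.bijective _).comp (hG.bijective.comp (Equiv.bijective _))
  edge_col y z h := by
    have := hG.edge_col _ _ ((act_out_inl g f G y z).1 h)
    rwa [outCol_vOutEquiv, inCol_vInEquiv] at this
  out_col y k h := by
    change Sum.map _ _ (G.out (vOutEquiv g y)) = _ at h
    rw [← outCol_vOutEquiv g]
    cases hy : G.out (vOutEquiv g y) with
    | inl z => simp [hy] at h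
    | inr k' =>
      rw [hy] at h
      rw [hG.out_col _ _ hy, ← Sum.inr_injective h]
      exact (BiProfile.outCol_outEquiv f k').symm
  inp_col k := by
    have h := hG.inp_col ((BiProfile.inEquiv f).symm k)
    rw [← BiProfile.inCol_inEquiv f, Equiv.apply_symm_apply] at h
    have e : vInEquiv g ((Wiring.act g f G).inp k) = G.inp ((BiProfile.inEquiv f).symm k) :=
      Equiv.apply_symm_apply _ _
    rw [h, ← inCol_vInEquiv g]
    exact congrArg (fun z : VIn A => (A.col z.1).inCol z.2) e.symm

theorem IsHorizontal.act {A' A : Arity (BiProfile C)} {d d' : BiProfile C} (g : A' ⟶ A)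
    (f : d ⟶ d') {G : Wiring A d} (hG : G.IsHorizontal) : (Wiring.act g f G).IsHorizontal :=
  ⟨(Nat.card_congr g.e).trans hG.1, fun y z h => hG.2 _ _ ((act_out_inl g f G y z).1 h)⟩

theorem IsContraction.act {A' A : Arity (BiProfile C)} {d d' : BiProfile C} (g : A' ⟶ A)
    (f : d ⟶ d') {G : Wiring A d} (hG : G.IsContraction) : (Wiring.act g f G).IsContraction := by
  refine ⟨(Nat.card_congr g.e).trans hG.1, ?_⟩
  obtain ⟨y, ⟨z, hz⟩, huniq⟩ := hG.2
  refine ⟨(vOutEquiv g).symm y, ⟨(vInEquiv g).symm z, ?_⟩, ?_⟩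
  · rw [act_out_inl, Equiv.apply_symm_apply, Equiv.apply_symm_apply, hz]
  · rintro y' ⟨z', h⟩
    rw [Equiv.eq_symm_apply]
    exact huniq _ ⟨_, (act_out_inl g f G y' z').1 h⟩

theorem IsProperadic.act {A' A : Arity (BiProfile C)} {d d' : BiProfile C} (g : A' ⟶ A)
    (f : d ⟶ d') {G : Wiring A d} (hG : G.IsProperadic) : (Wiring.act g f G).IsProperadic := by
  obtain ⟨hc, ⟨y, z, hz⟩, top, bot, hne, hdir⟩ := hG
  refine ⟨(Nat.card_congr g.e).trans hc, ⟨(vOutEquiv g).symm y, (vInEquiv g).symm z, ?_⟩,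
    g.e.symm top, g.e.symm bot, fun h => hne (g.e.symm.injective h), fun y' z' h => ?_⟩
  · rw [act_out_inl, Equiv.apply_symm_apply, Equiv.apply_symm_apply, hz]
  · rw [Equiv.eq_symm_apply, Equiv.eq_symm_apply]
    exact hdir _ _ ((act_out_inl g f G y' z').1 h)

/-- The graph whose vertices all have empty profile. -/
def ofEmpty (ι : Type) [Finite ι] [Nonempty ι] :
    Wiring (Arity.const ι (BiProfile.empty C)) (BiProfile.empty C) where
  out y := Fin.elim0 y.2
  inp k := Fin.elim0 k

theorem isGraph_ofEmpty (ι : Type) [Finite ι] [Nonempty ι] :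
    (ofEmpty (C := C) ι).IsGraph where
  bijective := by
    refine ⟨?_, ?_⟩
    · rintro (y | k)
      · exact Fin.elim0 y.2
      · exact Fin.elim0 k
    · rintro (z | k)
      · exact Fin.elim0 z.2
      · exact Fin.elim0 k
  edge_col y := Fin.elim0 y.2
  out_col y := Fin.elim0 y.2
  inp_col k := Fin.elim0 k

theorem isHorizontal_ofEmpty : (ofEmpty (C := C) (Fin 2)).IsHorizontal :=
  ⟨by simp, fun y => Fin.elim0 y.2⟩

end Wiring

/-- The generating module of the operad governing wheeled props: horizontal compositions and
contractions. -/
def wheeledGen (C : Type u) : GenModule (BiProfile C) where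
  obj A d := {G : Wiring A d // G.IsGraph ∧ (G.IsHorizontal ∨ G.IsContraction)}
  act g f G := ⟨Wiring.act g f G.1, G.2.1.act g f,
    G.2.2.imp (fun h => h.act g f) (fun h => h.act g f)⟩
  act_id G := Subtype.ext (Wiring.act_id G.1)
  act_act g' g f f' G := Subtype.ext (Wiring.act_act g' g f f' G.1)

/-- The generating module of the operad governing props: horizontal compositions and properadic
compositions. -/
def propGen (C : Type u) : GenModule (BiProfile C) where
  obj A d := {G : Wiring A d // G.IsGraph ∧ (G.IsHorizontal ∨ G.IsProperadic)}
  act g f G := ⟨Wiring.act g f G.1, G.2.1.act g f,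
    G.2.2.imp (fun h => h.act g f) (fun h => h.act g f)⟩
  act_id G := Subtype.ext (Wiring.act_id G.1)
  act_act g' g f f' G := Subtype.ext (Wiring.act_act g' g f f' G.1)

/-- The quadratic relations of the operad governing wheeled props: two composites of two generators
that form the same graph are equal.  The possible graphs are: three vertices without edges
(associativity of `⊗ₕ`); two vertices with one loop, formed by `⊗ₕ` after a contraction or by a
contraction after `⊗ₕ`; one vertex with two loops (the contractions commute). -/
inductive WheeledRel (K : Type x) (C : Type u) :
    ∀ (A : Arity (BiProfile C)) (d : BiProfile C),
      Raw K (wheeledGen C) A d → Raw K (wheeledGen C) A d → Prop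
  | mk {A B A' B' : Arity (BiProfile C)} {d : BiProfile C} (i : A.ι) (j : A'.ι)
      (G₁ : (wheeledGen C).obj A d) (G₂ : (wheeledGen C).obj B (A.col i))
      (H₁ : (wheeledGen C).obj A' d) (H₂ : (wheeledGen C).obj B' (A'.col j))
      (φ : A.subst i B ⟶ A'.subst j B')
      (h : Wiring.comp i G₁.1 G₂.1 = Wiring.act φ (𝟙 d) (Wiring.comp j H₁.1 H₂.1)) :
      WheeledRel K C (A.subst i B) d (Raw.comp i (Raw.gen G₁) (Raw.gen G₂))
        (Raw.act φ (𝟙 d) (Raw.comp j (Raw.gen H₁) (Raw.gen H₂)))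

/-- The quadratic relations of the operad governing props: two composites of two generators that form
the same graph are equal.  The possible graphs have three vertices: the caterpillar, the lighthouse,
the fireworks, the bow, the third wheel, and the graph without edges; the relations equate all the
ways to form them by horizontal and properadic compositions. -/
inductive PropRel (K : Type x) (C : Type u) :
    ∀ (A : Arity (BiProfile C)) (d : BiProfile C),
      Raw K (propGen C) A d → Raw K (propGen C) A d → Prop
  | mk {A B A' B' : Arity (BiProfile C)} {d : BiProfile C} (i : A.ι) (j : A'.ι)
      (G₁ : (propGen C).obj A d) (G₂ : (propGen C).obj B (A.col i))
      (H₁ : (propGen C).obj A' d) (H₂ : (propGen C).obj B' (A'.col j))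
      (φ : A.subst i B ⟶ A'.subst j B')
      (h : Wiring.comp i G₁.1 G₂.1 = Wiring.act φ (𝟙 d) (Wiring.comp j H₁.1 H₂.1)) :
      PropRel K C (A.subst i B) d (Raw.comp i (Raw.gen G₁) (Raw.gen G₂))
        (Raw.act φ (𝟙 d) (Raw.comp j (Raw.gen H₁) (Raw.gen H₂)))

/-- The operad `𝕎` governing `C`-coloured (non-unital) wheeled props. -/
def WOperad (K : Type x) [Field K] (C : Type u) : GOperad K (BiProfile C) :=
  GOperad.presented K (wheeledGen C) (WheeledRel K C)

/-- The operad `ℙ` governing `C`-coloured (non-unital) props. -/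
def POperad (K : Type x) [Field K] (C : Type u) : GOperad K (BiProfile C) :=
  GOperad.presented K (propGen C) (PropRel K C)

/-- The horizontal composition of two vertices with empty profiles, in `𝕎`. -/
def WOperad.eta (K : Type x) [Field K] (C : Type u) :
    (WOperad K C).obj (Arity.const (Fin 2) (BiProfile.empty C)) (BiProfile.empty C) :=
  GOperad.presentedGen K (WheeledRel K C)
    ⟨Wiring.ofEmpty (Fin 2), Wiring.isGraph_ofEmpty _, Or.inl Wiring.isHorizontal_ofEmpty⟩

/-- The horizontal composition of two vertices with empty profiles, in `ℙ`. -/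
def POperad.eta (K : Type x) [Field K] (C : Type u) :
    (POperad K C).obj (Arity.const (Fin 2) (BiProfile.empty C)) (BiProfile.empty C) :=
  GOperad.presentedGen K (PropRel K C)
    ⟨Wiring.ofEmpty (Fin 2), Wiring.isGraph_ofEmpty _, Or.inl Wiring.isHorizontal_ofEmpty⟩

/-- The morphism of groupoids that sends the only object to the pair of empty profiles. -/
def emptyColour (C : Type u) : OneObj ⥤ BiProfile C :=
  (Functor.const OneObj).obj (BiProfile.empty C)

end Graphs

/-! ### Morphisms of profiles -/

namespace Arity

variable {U : Type*} [Groupoid U] {V : Type*} [Groupoid V]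

/-! The argument has an upper bound and a lower bound, and the presented operad `ComPresented`
mediates between them.

Upper bound: in an operad generated by one commutative associative product, every monomial can be
rebracketed as a comb `a₁ · (a₂ · (⋯ · aₙ))`, and any two combs in the same inputs coincide. Both
facts reduce to three inputs: commutativity of the inner product gives a transposition,
associativity with commutativity of the outer product gives a 3-cycle, and these generate `Σ₃`
(`relabel_triple`). Combs are closed under composition (`Comb.cmp`) and unique (`Comb.unique`).
Hence every component of `ComPresented` is spanned by one comb, and vanishes below arity two.

Lower bound: a multiplicative functional with value 1 on the generator has value 1 on every comb, so
it is injective on each component (`IsMultiplicative.injective`). For the target `Com` this gives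
`ComPresented ≅ Com`. For `𝕎` and `ℙ` the functional comes from the morphism to the operad of
scalars that sends every generator to 1. It exists because every defining relation equates
composites of two generators, and both sides have value 1. Its restriction to the iterates of `η`
shows that `ComPresented` embeds.

Symmetry and associativity of `η` hold since vertices with empty profile have nothing to wire: there
is at most one graph on given empty vertices. The object with empty profiles has no automorphisms
and is isomorphic to no other object, so the suboperad generated by `η` lives on this colour alone
and is exactly the image. `IsDetectedProduct` collects these properties, so both operads are treated
by one argument. -/

theorem hom_ext {A B : Arity V} {g h : A ⟶ B} (he : ∀ i, g.e i = h.e i)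
    (hf : ∀ i, g.f i ≫ eqToHom (congrArg B.col (he i)) = h.f i) : g = h := by
  obtain ⟨e, f⟩ := g
  obtain ⟨e', f'⟩ := h
  obtain rfl : e = e' := Equiv.ext he
  refine congrArg _ (funext fun i => ?_)
  simpa using hf i

theorem mapHom_id (F : U ⥤ V) (A : Arity U) : mapHom F (𝟙 A) = 𝟙 (A.map F) :=
  Hom.ext rfl (heq_of_eq (funext fun i => F.map_id (A.col i)))

theorem mapHom_comp (F : U ⥤ V) {A B D : Arity U} (g : A ⟶ B) (h : B ⟶ D) :
    mapHom F (g ≫ h) = mapHom F g ≫ mapHom F h :=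
  Hom.ext rfl (heq_of_eq (funext fun i => F.map_comp (g.f i) (h.f (g.e i))))

/-- Naturality of `mapSubst`. This and the next two coherences are what the equivariance, sequential
and parallel axioms need when expressions are evaluated along `F`. All colour components are
identities or the same image under `F`, once the label is split into cases. -/
theorem mapHom_substHom_comp_mapSubst (F : U ⥤ V) {A' A B' B : Arity U} (g : A' ⟶ A) (i : A'.ι)
    (h : B' ⟶ B) :
    mapHom F (substHom g i h) ≫ mapSubst F A (g.e i) B =
      mapSubst F A' i B' ≫ substHom (mapHom F g) i (mapHom F h) := by
  refine hom_ext (by rintro (a | b) <;> rfl) ?_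
  rintro (a | b)
  · exact (Category.comp_id _).trans ((Category.comp_id _).trans (Category.id_comp _).symm)
  · exact (Category.comp_id _).trans ((Category.comp_id _).trans (Category.id_comp _).symm)

theorem mapSubst_comp_seqHom (F : U ⥤ V) (A : Arity U) (i : A.ι) (B : Arity U) (j : B.ι)
    (D : Arity U) :
    mapSubst F (A.subst i B) (Sum.inr j) D ≫
        substHom (mapSubst F A i B) (Sum.inr j) (𝟙 (D.map F)) ≫
        seqHom (A.map F) i (B.map F) j (D.map F) =
      mapHom F (seqHom A i B j D) ≫ mapSubst F A i (B.subst j D) ≫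
        substHom (𝟙 (A.map F)) i (mapSubst F B j D) := by
  refine hom_ext (by rintro (⟨a | b, h⟩ | d) <;> rfl) ?_
  rintro (⟨a | b, h⟩ | d)
  all_goals
    refine (Category.comp_id _).trans ?_
    refine (Category.id_comp _).trans ?_
    refine (Category.comp_id _).trans ?_
    refine Eq.trans ?_ (congrArg (· ≫ _) (F.map_id _).symm)
    refine Eq.trans ?_ (Category.id_comp _).symm
    exact (Category.comp_id _).symm

theorem mapSubst_comp_parHom (F : U ⥤ V) (A : Arity U) (i k : A.ι) (hik : i ≠ k)
    (B D : Arity U) :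
    mapSubst F (A.subst i B) (Sum.inl ⟨k, hik.symm⟩) D ≫
        substHom (mapSubst F A i B) (Sum.inl ⟨k, hik.symm⟩) (𝟙 (D.map F)) ≫
        parHom (A.map F) i k hik (B.map F) (D.map F) =
      mapHom F (parHom A i k hik B D) ≫ mapSubst F (A.subst k D) (Sum.inl ⟨i, hik⟩) B ≫
        substHom (mapSubst F A k D) (Sum.inl ⟨i, hik⟩) (𝟙 (B.map F)) := by
  refine hom_ext (by rintro (⟨a | b, h⟩ | d) <;> rfl) ?_
  rintro (⟨a | b, h⟩ | d)
  all_goals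
    refine (Category.comp_id _).trans ?_
    refine (Category.id_comp _).trans ?_
    refine (Category.comp_id _).trans ?_
    refine Eq.trans ?_ (congrArg (· ≫ _) (F.map_id _).symm)
    refine Eq.trans ?_ (Category.id_comp _).symm
    exact (Category.comp_id _).symm

end Arity

namespace GOperad

variable {K : Type x} [Field K]

/-! ### One-sided equivariance of the partial compositions -/

section Compositions

variable {V : Type*} [Groupoid V] (Q : GOperad K V)

theorem act_congr {A' A : Arity V} {d d' : V} {g h : A' ⟶ A} {f f' : d ⟶ d'} (hg : g = h)
    (hf : f = f') (α : Q.obj A d) : Q.act g f α = Q.act h f' α := by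
  rw [hg, hf]

theorem act_act_act {A₁ A₂ A₃ A₄ : Arity V} {d₁ d₂ d₃ d₄ : V} (g₁ : A₁ ⟶ A₂) (g₂ : A₂ ⟶ A₃)
    (g₃ : A₃ ⟶ A₄) (f₁ : d₁ ⟶ d₂) (f₂ : d₂ ⟶ d₃) (f₃ : d₃ ⟶ d₄) (α : Q.obj A₄ d₁) :
    Q.act g₁ f₃ (Q.act g₂ f₂ (Q.act g₃ f₁ α)) = Q.act (g₁ ≫ g₂ ≫ g₃) (f₁ ≫ f₂ ≫ f₃) α := by
  rw [Q.act_act, Q.act_act, Category.assoc]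

theorem comp_act_left {A' A B : Arity V} {d d' : V} (g : A' ⟶ A) (f : d ⟶ d') (i : A'.ι)
    (α : Q.obj A d) (β : Q.obj B (A'.col i)) :
    Q.comp i (Q.act g f α) β =
      Q.act (Arity.substHom g i (𝟙 B)) f (Q.comp (g.e i) α (Q.act (𝟙 B) (g.f i) β)) := by
  rw [← Q.comp_act, Q.act_id]

theorem comp_act_right {A B' B : Arity V} {d : V} (i : A.ι) (h : B' ⟶ B)
    (α : Q.obj A d) (β : Q.obj B (A.col i)) :
    Q.comp i α (Q.act h (𝟙 _) β) =
      Q.act (Arity.substHom (𝟙 A) i h) (𝟙 d) (Q.comp i α β) := by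
  have := Q.comp_act (𝟙 A) (𝟙 d) i h α β
  rw [Q.act_id] at this
  refine this.trans ?_
  exact congrArg (fun β' => Q.act (Arity.substHom (𝟙 A) i h) (𝟙 d) (Q.comp i α β')) (Q.act_id β)

end Compositions

/-! ### The universal property of a presented operad -/

section Lift

variable {U : Type*} [Groupoid U] {V : Type*} [Groupoid V]
  {E : GenModule U} {F : U ⥤ V} (Q : GOperad K V)
  (γ : ∀ (A : Arity U) (d : U), E.obj A d → Q.obj (A.map F) (F.obj d))

/-- The value of a formal operadic expression under an assignment of the generators. -/
def evalRaw : ∀ {A : Arity U} {d : U}, Raw K E A d → Q.obj (A.map F) (F.obj d)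
  | _, _, .gen e => γ _ _ e
  | _, _, .zero => 0
  | _, _, .add s t => evalRaw s + evalRaw t
  | _, _, .smul k t => k • evalRaw t
  | _, _, .act g f t => Q.act (Arity.mapHom F g) (F.map f) (evalRaw t)
  | _, _, .comp (A := A) (B := B) i s t =>
      Q.act (Arity.mapSubst F A i B) (𝟙 _)
        (Q.comp (A := A.map F) i (evalRaw s) (evalRaw t))

variable {R : ∀ (A : Arity U) (d : U), Raw K E A d → Raw K E A d → Prop}

/-- Each clause of the congruence is an axiom that `Q` satisfies. Only the three clauses on partial
compositions need work, because evaluation inserts a `mapSubst` after every composition. -/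
theorem evalRaw_eq_of_rel
    (hγ : ∀ {A' A : Arity U} {d d' : U} (g : A' ⟶ A) (f : d ⟶ d') (e : E.obj A d),
      γ A' d' (E.act g f e) = Q.act (Arity.mapHom F g) (F.map f) (γ A d e))
    (hR : ∀ {A : Arity U} {d : U} (s t : Raw K E A d), R A d s t →
      evalRaw Q γ s = evalRaw Q γ t)
    {A : Arity U} {d : U} {s t : Raw K E A d} (h : Raw.Rel R s t) :
    evalRaw Q γ s = evalRaw Q γ t := by
  induction h with
  | refl => rfl
  | symm _ ih => exact ih.symm
  | trans _ _ ih ih' => exact ih.trans ih'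
  | add_congr _ _ ih ih' => simp only [evalRaw, ih, ih']
  | smul_congr _ _ ih => simp only [evalRaw, ih]
  | act_congr _ _ _ ih => simp only [evalRaw, ih]
  | comp_congr _ _ _ ih ih' => simp only [evalRaw, ih, ih']
  | zero_add => simp only [evalRaw, zero_add]
  | add_comm => simp only [evalRaw]; exact add_comm _ _
  | add_assoc => simp only [evalRaw]; exact add_assoc _ _ _
  | zero_smul => simp only [evalRaw, zero_smul]
  | one_smul => simp only [evalRaw, one_smul]
  | mul_smul => simp only [evalRaw, mul_smul]
  | smul_add => simp only [evalRaw, smul_add]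
  | add_smul => simp only [evalRaw, add_smul]
  | act_add => simp only [evalRaw, map_add]
  | act_smul => simp only [evalRaw, map_smul]
  | comp_add_left => simp only [evalRaw, map_add, LinearMap.add_apply]
  | comp_smul_left => simp only [evalRaw, map_smul, LinearMap.smul_apply]
  | comp_add_right => simp only [evalRaw, map_add]
  | comp_smul_right => simp only [evalRaw, map_smul]
  | act_id => simp only [evalRaw, Arity.mapHom_id, F.map_id, Q.act_id]
  | act_act => simp only [evalRaw, Arity.mapHom_comp, F.map_comp, Q.act_act]
  | comp_act g f i h s t =>
    simp only [evalRaw]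
    rw [F.map_id, Arity.mapHom_id, Q.act_act, Category.id_comp]
    refine (congrArg _ (Q.comp_act (Arity.mapHom F g) (F.map f) i (Arity.mapHom F h)
      _ _)).trans ?_
    rw [Q.act_act, Arity.mapHom_substHom_comp_mapSubst, Category.comp_id]
    rfl
  | @comp_seq A B D d i j r s t =>
    simp only [evalRaw]
    -- `hl` and `hr` pull the inner `mapSubst` out of the left and of the right factor. After the
    -- sequential law both sides are one action on the same nested composite, and the coherence
    -- compares the two morphisms.
    have hl := (Q.comp_act_left (B := D.map F) (Arity.mapSubst F A i B) (𝟙 (F.obj d))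
      (Sum.inr j) (Q.comp (A := A.map F) i (evalRaw Q γ r) (evalRaw Q γ s)) (evalRaw Q γ t)).trans
      (congrArg (fun z => Q.act _ _ (Q.comp (A := (A.map F).subst i (B.map F)) (Sum.inr j)
        (Q.comp (A := A.map F) i (evalRaw Q γ r) (evalRaw Q γ s)) z)) (Q.act_id (evalRaw Q γ t)))
    have hr := Q.comp_act_right (A := A.map F) i (Arity.mapSubst F B j D) (evalRaw Q γ r)
      (Q.comp (A := B.map F) j (evalRaw Q γ s) (evalRaw Q γ t))
    rw [Q.comp_seq (A := A.map F) (B := B.map F) (D := D.map F) i j] at hl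
    refine (congrArg (Q.act _ _) hl).trans ?_
    refine Eq.trans ?_ (congrArg (fun z => Q.act _ _ (Q.act _ _ z)) hr).symm
    refine (Q.act_act_act _ _ _ _ _ _ _).trans (Eq.trans ?_ (Q.act_act_act _ _ _ _ _ _ _).symm)
    refine Q.act_congr ?_ ?_ _
    · exact Arity.mapSubst_comp_seqHom F A i B j D
    · exact congrArg (fun z => 𝟙 _ ≫ 𝟙 _ ≫ z) (F.map_id d).symm
  | @comp_par A B D d i k hik r s t =>
    simp only [evalRaw]
    have hl := (Q.comp_act_left (B := D.map F) (Arity.mapSubst F A i B) (𝟙 (F.obj d))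
      (Sum.inl ⟨k, hik.symm⟩) (Q.comp (A := A.map F) i (evalRaw Q γ r) (evalRaw Q γ s))
      (evalRaw Q γ t)).trans
      (congrArg (fun z => Q.act _ _ (Q.comp (A := (A.map F).subst i (B.map F))
        (Sum.inl ⟨k, hik.symm⟩) (Q.comp (A := A.map F) i (evalRaw Q γ r) (evalRaw Q γ s)) z))
        (Q.act_id (evalRaw Q γ t)))
    have hr := (Q.comp_act_left (B := B.map F) (Arity.mapSubst F A k D) (𝟙 (F.obj d))
      (Sum.inl ⟨i, hik⟩) (Q.comp (A := A.map F) k (evalRaw Q γ r) (evalRaw Q γ t))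
      (evalRaw Q γ s)).trans
      (congrArg (fun z => Q.act _ _ (Q.comp (A := (A.map F).subst k (D.map F))
        (Sum.inl ⟨i, hik⟩) (Q.comp (A := A.map F) k (evalRaw Q γ r) (evalRaw Q γ t)) z))
        (Q.act_id (evalRaw Q γ s)))
    rw [Q.comp_par (A := A.map F) (B := B.map F) (D := D.map F) i k hik] at hl
    refine (congrArg (Q.act _ _) hl).trans ?_
    refine Eq.trans ?_ (congrArg (fun z => Q.act _ _ (Q.act _ _ z)) hr).symm
    refine (Q.act_act_act _ _ _ _ _ _ _).trans (Eq.trans ?_ (Q.act_act_act _ _ _ _ _ _ _).symm)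
    refine Q.act_congr ?_ ?_ _
    · exact Arity.mapSubst_comp_parHom F A i k hik B D
    · exact congrArg (fun z => 𝟙 _ ≫ 𝟙 _ ≫ z) (F.map_id d).symm
  | gen_act g f e => exact (hγ g f e).symm
  | rel h => exact hR _ _ h

/-- The morphism out of a presented operad defined by the images of the generators. -/
def lift
    (hγ : ∀ {A' A : Arity U} {d d' : U} (g : A' ⟶ A) (f : d ⟶ d') (e : E.obj A d),
      γ A' d' (E.act g f e) = Q.act (Arity.mapHom F g) (F.map f) (γ A d e))
    (hR : ∀ {A : Arity U} {d : U} (s t : Raw K E A d), R A d s t →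
      evalRaw Q γ s = evalRaw Q γ t) :
    Hom F (presented K E R) Q where
  app A d :=
    { toFun := Quotient.lift (evalRaw Q γ) (fun _ _ h => evalRaw_eq_of_rel Q γ hγ hR h)
      map_add' := by rintro ⟨a⟩ ⟨b⟩; rfl
      map_smul' := by rintro k ⟨a⟩; rfl }
  app_act := by rintro A' A d d' g f ⟨a⟩; rfl
  app_comp := by rintro A B d i ⟨a⟩ ⟨b⟩; rfl

end Lift

end GOperad

/-! ### Operads with one colour -/

/-- In the one-coloured case a morphism of profiles is a bijection of labels. -/
def Arity.homOfEquiv {A B : Arity OneObj} (e : A.ι ≃ B.ι) : A ⟶ B :=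
  ⟨e, fun _ => 𝟙 OneObj.star⟩

theorem Arity.oneObj_hom_ext {A B : Arity OneObj} {g h : A ⟶ B} (he : ∀ i, g.e i = h.e i) :
    g = h :=
  Arity.hom_ext he fun _ => Subsingleton.elim _ _

namespace GOperad

section OneColour

variable {K : Type x} [Field K] (P : GOperad K OneObj)

/-- The action of a bijection of labels. -/
def relabel {A B : Arity OneObj} (e : A.ι ≃ B.ι) :
    P.obj B OneObj.star →ₗ[K] P.obj A OneObj.star :=
  P.act (Arity.homOfEquiv e) (𝟙 _)

/-- The partial composition in a one-coloured operad. -/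
def cmp {A B : Arity OneObj} (i : A.ι) (α : P.obj A OneObj.star) (β : P.obj B OneObj.star) :
    P.obj (A.subst i B) OneObj.star :=
  P.comp i α β

theorem act_eq_relabel {A B : Arity OneObj} (g : A ⟶ B) (f : OneObj.star ⟶ OneObj.star)
    (α : P.obj B OneObj.star) : P.act g f α = P.relabel g.e α :=
  P.act_congr (Arity.oneObj_hom_ext fun _ => rfl) (Subsingleton.elim _ _) α

theorem relabel_refl {A : Arity OneObj} (α : P.obj A OneObj.star) :
    P.relabel (Equiv.refl A.ι) α = α := by
  refine Eq.trans ?_ (P.act_id α)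
  exact P.act_congr (Arity.oneObj_hom_ext fun _ => rfl) rfl α

theorem relabel_relabel {A B D : Arity OneObj} (e : A.ι ≃ B.ι) (e' : B.ι ≃ D.ι)
    (α : P.obj D OneObj.star) : P.relabel e (P.relabel e' α) = P.relabel (e.trans e') α := by
  refine (P.act_act _ _ _ _ α).trans ?_
  exact P.act_congr (Arity.oneObj_hom_ext fun _ => rfl) (Subsingleton.elim _ _) α

theorem cmp_relabel {A' A B' B : Arity OneObj} (e : A'.ι ≃ A.ι) (h : B'.ι ≃ B.ι) (i : A'.ι)
    (α : P.obj A OneObj.star) (β : P.obj B OneObj.star) :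
    P.cmp i (P.relabel e α) (P.relabel h β) =
      P.relabel (A := A'.subst i B') (B := A.subst (e i) B)
        (Equiv.sumCongr (e.subtypeEquiv (fun a => by simp)) h) (P.cmp (e i) α β) := by
  refine (P.comp_act (Arity.homOfEquiv e) (𝟙 OneObj.star) i (Arity.homOfEquiv h) α β).trans ?_
  refine (congrArg (fun z => P.act _ _ (P.comp (e i) α z)) (P.act_id β)).trans ?_
  exact P.act_congr (Arity.oneObj_hom_ext fun _ => rfl) (Subsingleton.elim _ _) _

theorem cmp_relabel_right {A B' B : Arity OneObj} (h : B'.ι ≃ B.ι) (i : A.ι)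
    (α : P.obj A OneObj.star) (β : P.obj B OneObj.star) :
    P.cmp i α (P.relabel h β) =
      P.relabel (A := A.subst i B') (B := A.subst i B)
        (Equiv.sumCongr (Equiv.refl _) h) (P.cmp i α β) := by
  have := P.cmp_relabel (Equiv.refl A.ι) h i α β
  rw [relabel_refl] at this
  exact this

/-- The target input `j` is kept apart from `e i` so that a propositional equality suffices. The
bijection `e'` is described only by its effect on the two summands, which is all that later
arguments use. -/
theorem cmp_relabel_left {A' A B : Arity OneObj} (e : A'.ι ≃ A.ι) (i : A'.ι) {j : A.ι}
    (hj : e i = j) (α : P.obj A OneObj.star) (β : P.obj B OneObj.star) :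
    ∃ e' : (A'.subst i B).ι ≃ (A.subst j B).ι,
      P.cmp i (P.relabel e α) β = P.relabel e' (P.cmp j α β) ∧
      (∀ a : {a // a ≠ i}, ∃ h, e' (Sum.inl a) = Sum.inl ⟨e a.1, h⟩) ∧
      ∀ b, e' (Sum.inr b) = Sum.inr b := by
  subst hj
  refine ⟨Equiv.sumCongr (e.subtypeEquiv (fun a => by simp)) (Equiv.refl _), ?_,
    fun a => ⟨fun h => a.2 (e.injective h), rfl⟩, fun b => rfl⟩
  rw [← P.cmp_relabel e (Equiv.refl _) i α β, relabel_refl]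

theorem cmp_seq {A B D : Arity OneObj} (i : A.ι) (j : B.ι) (α : P.obj A OneObj.star)
    (β : P.obj B OneObj.star) (γ : P.obj D OneObj.star) :
    P.cmp (A := A.subst i B) (Sum.inr j) (P.cmp i α β) γ =
      P.relabel (Arity.seqEquiv A i B j D) (P.cmp i α (P.cmp j β γ)) :=
  (P.comp_seq i j α β γ).trans (P.act_eq_relabel _ _ _)

theorem cmp_par {A B D : Arity OneObj} (i k : A.ι) (hik : i ≠ k) (α : P.obj A OneObj.star)
    (β : P.obj B OneObj.star) (γ : P.obj D OneObj.star) :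
    P.cmp (A := A.subst i B) (Sum.inl ⟨k, hik.symm⟩) (P.cmp i α β) γ =
      P.relabel (Arity.parEquiv A i k hik B D)
        (P.cmp (A := A.subst k D) (Sum.inl ⟨i, hik⟩) (P.cmp k α γ) β) :=
  (P.comp_par i k hik α β γ).trans (P.act_eq_relabel _ _ _)

end OneColour

end GOperad

/-! ### The monomials in a commutative and associative product -/

namespace ComPresented

variable (K : Type x) [Field K]

/-- The product of two labelled inputs. -/
def gen (A : Arity OneObj) (h : Nat.card A.ι = 2) : (ComPresented K).obj A OneObj.star :=
  GOperad.presentedGen K (AssocRel K) (⟨h⟩ : binaryGen.obj A OneObj.star)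

variable {K}

theorem relabel_gen {A B : Arity OneObj} (e : A.ι ≃ B.ι) (hA : Nat.card A.ι = 2)
    (hB : Nat.card B.ι = 2) : (ComPresented K).relabel e (gen K B hB) = gen K A hA :=
  Quotient.sound (Raw.Rel.gen_act _ _ _)

/-- The profile with two inputs. -/
abbrev two : Arity OneObj := Arity.const (Fin 2) OneObj.star

theorem card_two : Nat.card two.ι = 2 := by simp

/-- The product of three inputs. -/
def triple (K : Type x) [Field K] :
    (ComPresented K).obj (two.subst (0 : Fin 2) two) OneObj.star :=
  (ComPresented K).cmp (A := two) (0 : Fin 2) (gen K two card_two) (gen K two card_two)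

theorem triple_eq : triple K = (ComPresented K).relabel
    (A := two.subst (0 : Fin 2) two) (B := two.subst (1 : Fin 2) two) Arity.ternaryEquiv
    ((ComPresented K).cmp (A := two) (1 : Fin 2) (gen K two card_two) (gen K two card_two)) := by
  refine Eq.trans ?_ ((ComPresented K).act_eq_relabel (Arity.ternaryHom OneObj.star) (𝟙 _) _)
  exact Quotient.sound (Raw.Rel.rel AssocRel.assoc)

/-- The transposition of the two inner inputs. -/
def innerSwap : Equiv.Perm ({a : Fin 2 // a ≠ 0} ⊕ Fin 2) :=
  Equiv.sumCongr (Equiv.refl _) (Equiv.swap 0 1)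

/-- The permutation of the inputs by which associativity and commutativity of the outer product
act. -/
def outerCycle : Equiv.Perm ({a : Fin 2 // a ≠ 0} ⊕ Fin 2) :=
  Arity.ternaryEquiv.trans
    (Equiv.sumCongr ((Equiv.swap (0 : Fin 2) 1).subtypeEquiv (by decide)) (Equiv.refl _))

theorem relabel_innerSwap :
    (ComPresented K).relabel (A := two.subst (0 : Fin 2) two) innerSwap (triple K) = triple K := by
  have := (ComPresented K).cmp_relabel_right (A := two) (B' := two) (B := two)
    (Equiv.swap (0 : Fin 2) 1) (0 : Fin 2) (gen K two card_two) (gen K two card_two)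
  rw [relabel_gen _ card_two] at this
  exact this.symm

/-- Associativity turns composition at input 0 into composition at input 1, and commutativity of the
outer product turns it back. The total effect on the three inputs is a 3-cycle. -/
theorem relabel_outerCycle :
    (ComPresented K).relabel (A := two.subst (0 : Fin 2) two) outerCycle (triple K) =
      triple K := by
  have := (ComPresented K).cmp_relabel (A' := two) (A := two) (B' := two) (B := two)
    (Equiv.swap (0 : Fin 2) 1) (Equiv.refl _) (1 : Fin 2) (gen K two card_two)
    (gen K two card_two)
  rw [relabel_gen _ card_two, GOperad.relabel_refl] at this
  exact ((triple_eq.trans (congrArg _ this)).trans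
    ((ComPresented K).relabel_relabel _ _ _)).symm

/-- A transposition and a 3-cycle generate `Σ₃`. -/
theorem relabel_triple (σ : Equiv.Perm ({a : Fin 2 // a ≠ 0} ⊕ Fin 2)) :
    (ComPresented K).relabel (A := two.subst (0 : Fin 2) two) σ (triple K) = triple K := by
  have h2 : ∀ σ τ : Equiv.Perm ({a : Fin 2 // a ≠ 0} ⊕ Fin 2),
      (ComPresented K).relabel (A := two.subst (0 : Fin 2) two) σ (triple K) = triple K →
      (ComPresented K).relabel (A := two.subst (0 : Fin 2) two) τ (triple K) = triple K →
      (ComPresented K).relabel (A := two.subst (0 : Fin 2) two) (σ.trans τ) (triple K) =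
        triple K := by
    intro σ τ hσ hτ
    refine ((ComPresented K).relabel_relabel (A := two.subst (0 : Fin 2) two)
      (B := two.subst (0 : Fin 2) two) (D := two.subst (0 : Fin 2) two) σ τ _).symm.trans ?_
    rw [hτ, hσ]
  have hs := relabel_innerSwap (K := K)
  have hc := relabel_outerCycle (K := K)
  -- These words in the two generators cover all six permutations, with repetitions.
  have key : ∀ σ : Equiv.Perm ({a : Fin 2 // a ≠ 0} ⊕ Fin 2),
      σ ∈ [innerSwap, outerCycle, innerSwap.trans innerSwap, innerSwap.trans outerCycle,
        outerCycle.trans innerSwap, outerCycle.trans outerCycle,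
        (innerSwap.trans outerCycle).trans innerSwap,
        (outerCycle.trans innerSwap).trans outerCycle] := by decide
  have := key σ
  simp only [List.mem_cons, List.not_mem_nil, or_false] at this
  rcases this with rfl | rfl | rfl | rfl | rfl | rfl | rfl | rfl
  · exact hs
  · exact hc
  · exact h2 _ _ hs hs
  · exact h2 _ _ hs hc
  · exact h2 _ _ hc hs
  · exact h2 _ _ hc hc
  · exact h2 _ _ (h2 _ _ hs hc) hs
  · exact h2 _ _ (h2 _ _ hc hs) hc

theorem exists_equiv_two {A : Arity OneObj} (h : Nat.card A.ι = 2) (i : A.ι) :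
    ∃ e : A.ι ≃ Fin 2, e i = 0 := by
  obtain ⟨e⟩ : Nonempty (A.ι ≃ Fin 2) := Finite.card_eq.1 (by simpa using h)
  exact ⟨e.trans (Equiv.swap (e i) 0), by simp⟩

/-- A product of three inputs does not depend on the order or the bracketing. -/
theorem relabel_cmp_gen {T A B : Arity OneObj} (i : A.ι) (hA : Nat.card A.ι = 2)
    (hB : Nat.card B.ι = 2) (e : T.ι ≃ (A.subst i B).ι)
    (e' : T.ι ≃ (two.subst (0 : Fin 2) two).ι) :
    (ComPresented K).relabel e ((ComPresented K).cmp i (gen K A hA) (gen K B hB)) =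
      (ComPresented K).relabel e' (triple K) := by
  obtain ⟨f, hf⟩ := exists_equiv_two hA i
  obtain ⟨g⟩ : Nonempty (B.ι ≃ two.ι) := Finite.card_eq.1 (hB.trans card_two.symm)
  obtain ⟨s, hs, -⟩ := (ComPresented K).cmp_relabel_left (A := two) f i hf (gen K two card_two)
    (gen K B hB)
  rw [relabel_gen _ hA] at hs
  have hr := (ComPresented K).cmp_relabel_right (A := two) g (0 : Fin 2) (gen K two card_two)
    (gen K two card_two)
  rw [relabel_gen g hB] at hr
  rw [hs, hr, GOperad.relabel_relabel, GOperad.relabel_relabel]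
  set r : T.ι ≃ (two.subst (0 : Fin 2) two).ι :=
    (e.trans s).trans (Equiv.sumCongr (Equiv.refl _) g)
  -- Both sides are now relabellings of `triple`; they differ by a permutation of its inputs, which
  -- `triple` absorbs.
  refine Eq.trans ?_ (congrArg _ (relabel_triple (K := K) (e'.symm.trans r)))
  rw [GOperad.relabel_relabel, ← Equiv.trans_assoc, Equiv.self_trans_symm, Equiv.refl_trans]
  rfl

end ComPresented

/-! ### Combs: closure under composition and uniqueness -/

namespace ComPresented

variable {K : Type x} [Field K]

/-- The monomials of the form `a₁ · (a₂ · (⋯ · aₙ))`, for some enumeration of the inputs. -/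
inductive Comb : ∀ {A : Arity OneObj}, (ComPresented K).obj A OneObj.star → Prop
  | gen (A : Arity OneObj) (h : Nat.card A.ι = 2) : Comb (gen K A h)
  | mul {A D B : Arity OneObj} (h : Nat.card D.ι = 2) (k : D.ι) (e : A.ι ≃ (D.subst k B).ι)
      {y : (ComPresented K).obj B OneObj.star} (hy : Comb y) :
      Comb ((ComPresented K).relabel e ((ComPresented K).cmp k (ComPresented.gen K D h) y))

theorem Comb.relabel {A B : Arity OneObj} (e : A.ι ≃ B.ι)
    {x : (ComPresented K).obj B OneObj.star} (hx : Comb x) :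
    Comb ((ComPresented K).relabel e x) := by
  cases hx with
  | gen _ h => rw [relabel_gen e ((Nat.card_congr e).trans h)]; exact .gen _ _
  | mul h k e' hy => rw [GOperad.relabel_relabel]; exact .mul h k _ hy

theorem Comb.gen_cmp {D B : Arity OneObj} (h : Nat.card D.ι = 2) (k : D.ι)
    {y : (ComPresented K).obj B OneObj.star} (hy : Comb y) :
    Comb ((ComPresented K).cmp k (ComPresented.gen K D h) y) := by
  rw [← (ComPresented K).relabel_refl (A := D.subst k B)
    ((ComPresented K).cmp k (ComPresented.gen K D h) y)]
  exact .mul h k (Equiv.refl _) hy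

theorem card_subst (A : Arity OneObj) (i : A.ι) (B : Arity OneObj) :
    Nat.card (A.subst i B).ι + 1 = Nat.card A.ι + Nat.card B.ι := by
  have h : Nat.card A.ι = Nat.card {a : A.ι // a ≠ i} + 1 := by
    classical
    rw [← Finite.card_option]
    exact Nat.card_congr (Equiv.optionSubtypeNe i).symm
  change Nat.card ({a : A.ι // a ≠ i} ⊕ B.ι) + 1 = _
  rw [Nat.card_sum, h]
  ring

theorem card_triple : Nat.card (two.subst (0 : Fin 2) two).ι = 3 := by
  have := card_subst two (0 : Fin 2) two
  rw [card_two] at this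
  omega

theorem exists_equiv_triple {T : Arity OneObj} (h : Nat.card T.ι = 3) (t : T.ι)
    (s : (two.subst (0 : Fin 2) two).ι) :
    ∃ e : T.ι ≃ (two.subst (0 : Fin 2) two).ι, e t = s := by
  classical
  obtain ⟨e⟩ : Nonempty (T.ι ≃ (two.subst (0 : Fin 2) two).ι) :=
    Finite.card_eq.1 (h.trans card_triple.symm)
  exact ⟨e.trans (Equiv.swap (e t) s), by simp⟩

/-- By full symmetry of `triple`, any chosen input may be placed in any chosen slot. Every
rebracketing of combs below uses this freedom. -/
theorem gen_cmp_gen {A B : Arity OneObj} (i : A.ι) (hA : Nat.card A.ι = 2)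
    (hB : Nat.card B.ι = 2) (t : (A.subst i B).ι) (s : (two.subst (0 : Fin 2) two).ι) :
    ∃ e : (A.subst i B).ι ≃ (two.subst (0 : Fin 2) two).ι, e t = s ∧
      (ComPresented K).cmp i (gen K A hA) (gen K B hB) =
        (ComPresented K).relabel e (triple K) := by
  obtain ⟨e, he⟩ := exists_equiv_triple (T := A.subst i B)
    (by have := card_subst A i B; omega) t s
  refine ⟨e, he, ?_⟩
  rw [← relabel_cmp_gen i hA hB (Equiv.refl _) e, GOperad.relabel_refl]

theorem triple_cmp {B : Arity OneObj} (l : Fin 2) (y : (ComPresented K).obj B OneObj.star) :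
    (ComPresented K).cmp (A := two.subst (0 : Fin 2) two) (Sum.inr l) (triple K) y =
      (ComPresented K).relabel (Arity.seqEquiv two (0 : Fin 2) two l B)
        ((ComPresented K).cmp (A := two) (0 : Fin 2) (gen K two card_two)
          ((ComPresented K).cmp (A := two) l (gen K two card_two) y)) :=
  (ComPresented K).cmp_seq (A := two) (B := two) (0 : Fin 2) l _ _ y

/-- Induction on the comb, according to whether the input that is replaced is its head or lies in
its tail. -/
theorem Comb.cmp_gen {A : Arity OneObj} {x : (ComPresented K).obj A OneObj.star}
    (hx : Comb x) (i : A.ι) {B : Arity OneObj} (hB : Nat.card B.ι = 2) :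
    Comb ((ComPresented K).cmp i x (ComPresented.gen K B hB)) := by
  induction hx with
  | gen A h => exact .gen_cmp h i (.gen B hB)
  | @mul A D B' h k e y hy ih =>
    obtain ⟨j, hj⟩ : ∃ j, e i = j := ⟨_, rfl⟩
    obtain ⟨e', he', -⟩ := (ComPresented K).cmp_relabel_left e i hj
      ((ComPresented K).cmp k (ComPresented.gen K D h) y) (ComPresented.gen K B hB)
    rw [he']
    refine Comb.relabel e' ?_
    rcases j with ⟨k', hk'⟩ | b
    -- Head: `(a · b) · y` is a threefold product with `y` substituted in one slot. Placing that
    -- slot inside the inner product gives `a · (b · y)` up to relabelling.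
    · rw [GOperad.cmp_par (ComPresented K) k k' hk'.symm]
      refine Comb.relabel _ ?_
      obtain ⟨r, hr, hg⟩ := gen_cmp_gen (K := K) k' h hB (Sum.inl ⟨k, hk'.symm⟩)
        (Sum.inr (0 : Fin 2))
      rw [hg]
      obtain ⟨e'', he'', -⟩ := (ComPresented K).cmp_relabel_left r _ hr (triple K) y
      rw [he'']
      refine Comb.relabel e'' ?_
      rw [triple_cmp]
      exact Comb.relabel _ (.gen_cmp _ _ (.gen_cmp _ _ hy))
    -- Tail: the composition is carried out inside `y`.
    · rw [GOperad.cmp_seq]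
      exact Comb.relabel _ (.gen_cmp h k (ih b))

/-- Induction on the second factor: substituting `b · y` into `x` is substituting a binary product,
by `Comb.cmp_gen`, and then `y`. The first factor therefore has to vary in the induction. -/
theorem Comb.cmp {A B : Arity OneObj} {x : (ComPresented K).obj A OneObj.star}
    {y : (ComPresented K).obj B OneObj.star} (hx : Comb x) (i : A.ι) (hy : Comb y) :
    Comb ((ComPresented K).cmp i x y) := by
  induction hy generalizing A with
  | gen B h => exact hx.cmp_gen i h
  | @mul B D B' h k e y hy ih =>
    rw [GOperad.cmp_relabel_right]
    refine Comb.relabel _ ?_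
    have := (ComPresented K).cmp_seq i k x (ComPresented.gen K D h) y
    have h' : (ComPresented K).cmp i x ((ComPresented K).cmp k (ComPresented.gen K D h) y) =
        (ComPresented K).relabel (Arity.seqEquiv A i D k B').symm
          ((ComPresented K).cmp (A := A.subst i D) (Sum.inr k)
            ((ComPresented K).cmp i x (ComPresented.gen K D h)) y) := by
      rw [this, GOperad.relabel_relabel, Equiv.symm_trans_self, GOperad.relabel_refl]
    rw [h']
    exact Comb.relabel _ (ih (hx.cmp_gen i h) (Sum.inr k))

theorem Comb.two_le_card {A : Arity OneObj} {x : (ComPresented K).obj A OneObj.star}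
    (hx : Comb x) : 2 ≤ Nat.card A.ι := by
  induction hx with
  | gen A h => exact h.ge
  | @mul A D B h k e y hy ih =>
    have := card_subst D k B
    rw [Nat.card_congr e]
    omega

theorem Comb.eq_gen {A : Arity OneObj} {x : (ComPresented K).obj A OneObj.star}
    (hx : Comb x) (h : Nat.card A.ι = 2) : x = ComPresented.gen K A h := by
  cases hx with
  | gen A h => rfl
  | @mul _ D B h' k e y hy =>
    have := card_subst D k B
    have := hy.two_le_card
    rw [Nat.card_congr e] at h
    omega

/-- Any chosen input can be made the head of a comb: by induction it becomes the head of the tail,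
and a threefold product lets it change places with the head. -/
theorem Comb.exists_mul {A : Arity OneObj} {x : (ComPresented K).obj A OneObj.star}
    (hx : Comb x) (hA : Nat.card A.ι ≠ 2) (a : A.ι) :
    ∃ (D B : Arity OneObj) (h : Nat.card D.ι = 2) (k : D.ι) (e : A.ι ≃ (D.subst k B).ι)
      (y : (ComPresented K).obj B OneObj.star), Comb y ∧ (∃ a', e a = Sum.inl a') ∧
      x = (ComPresented K).relabel e ((ComPresented K).cmp k (ComPresented.gen K D h) y) := by
  induction hx with
  | gen A h => exact absurd h hA
  | @mul A D B h k e y hy ih =>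
    rcases he : e a with a' | b
    · exact ⟨D, B, h, k, e, y, hy, ⟨a', he⟩, rfl⟩
    -- A binary tail has no head to speak of; the whole comb is then a threefold product and is
    -- permuted directly.
    by_cases hB : Nat.card B.ι = 2
    · obtain ⟨r, hr, hg⟩ := gen_cmp_gen (K := K) k h hB (Sum.inr b)
        (Sum.inl ⟨(1 : Fin 2), by decide⟩)
      refine ⟨two, two, card_two, (0 : Fin 2), e.trans r, _, .gen two card_two,
        ⟨⟨(1 : Fin 2), by decide⟩, ?_⟩, ?_⟩
      · exact (congrArg r he).trans hr
      · rw [hy.eq_gen hB, hg, GOperad.relabel_relabel]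
        rfl
    · obtain ⟨D₁, B₁, h₁, l, e₁, y₁, hy₁, ⟨b₁, hb₁⟩, rfl⟩ := ih hB b
      obtain ⟨r, hr, hg⟩ := gen_cmp_gen (K := K) k h h₁ (Sum.inr b₁.1)
        (Sum.inl ⟨(1 : Fin 2), by decide⟩)
      -- The single outer slot is taken by `b₁`, so the slot that receives `y₁` is an inner one.
      have hl : ∃ l', r (Sum.inr l) = Sum.inr l' := by
        rcases hl : r (Sum.inr l) with c | l'
        · exfalso
          have hc : c = ⟨(1 : Fin 2), by decide⟩ := by
            obtain ⟨c, hc⟩ := c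
            exact Subtype.ext (Fin.eq_one_of_ne_zero c hc)
          rw [hc, ← hr] at hl
          exact b₁.2 (Sum.inr_injective (r.injective hl)).symm
        · exact ⟨l', rfl⟩
      obtain ⟨l', hl'⟩ := hl
      obtain ⟨s, hs, hs₁, hs₂⟩ := (ComPresented K).cmp_relabel_left r (Sum.inr l) hl'
        (triple K) y₁
      rw [← hg, GOperad.cmp_seq, triple_cmp] at hs
      have hs' := congrArg ((ComPresented K).relabel (Arity.seqEquiv D k D₁ l B₁).symm) hs
      rw [GOperad.relabel_relabel, Equiv.symm_trans_self, GOperad.relabel_refl] at hs'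
      rw [GOperad.cmp_relabel_right, hs']
      simp only [GOperad.relabel_relabel]
      refine ⟨two, _, card_two, _, _, _, .gen_cmp card_two l' hy₁,
        ⟨⟨(1 : Fin 2), by decide⟩, ?_⟩, rfl⟩
      obtain ⟨hne, hs₁⟩ := hs₁ ⟨Sum.inr b₁.1, fun h' => b₁.2 (Sum.inr_injective h')⟩
      simp only [Equiv.trans_apply, he, Equiv.sumCongr_apply, Sum.map_inr, hb₁]
      have hseq : (Arity.seqEquiv D k D₁ l B₁).symm (Sum.inr (Sum.inl b₁)) =
        Sum.inl ⟨Sum.inr b₁.1, fun h' => b₁.2 (Sum.inr_injective h')⟩ := rfl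
      rw [hseq, hs₁]
      simp only [hr]
      rfl

/-- Used to cancel a common head: with one-point left summands that correspond, the tails correspond
too. -/
theorem exists_equiv_of_map_inl {α α' β β' : Type*} [Subsingleton α] [Subsingleton α']
    (s : α ⊕ β ≃ α' ⊕ β') (a : α) (a' : α') (h : s (Sum.inl a) = Sum.inl a') :
    ∃ r : β ≃ β', ∀ b, s (Sum.inr b) = Sum.inr (r b) := by
  have h₁ : ∀ b, ∃ b', s (Sum.inr b) = Sum.inr b' := by
    intro b
    rcases hb : s (Sum.inr b) with c | b'
    · rw [Subsingleton.elim c a', ← h] at hb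
      exact absurd (s.injective hb) Sum.inr_ne_inl
    · exact ⟨b', rfl⟩
  choose r hr using h₁
  refine ⟨Equiv.ofBijective r ⟨fun b c hbc => ?_, fun b' => ?_⟩, hr⟩
  · exact Sum.inr_injective (s.injective ((hr b).trans (hbc ▸ (hr c).symm)))
  · rcases hb : s.symm (Sum.inr b') with c | b
    · rw [Subsingleton.elim c a, Equiv.symm_apply_eq, h] at hb
      exact absurd hb Sum.inr_ne_inl
    · rw [Equiv.symm_apply_eq, hr] at hb
      exact ⟨b, (Sum.inr_injective hb).symm⟩

theorem subsingleton_ne {D : Arity OneObj} (h : Nat.card D.ι = 2) (k : D.ι) :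
    Subsingleton {a : D.ι // a ≠ k} := by
  have := card_subst D k two
  change Nat.card ({a : D.ι // a ≠ k} ⊕ Fin 2) + 1 = _ at this
  rw [Nat.card_sum, card_two] at this
  exact Finite.card_le_one_iff_subsingleton.1 (by omega)

/-- Monomials in the same inputs are equal. -/
theorem Comb.unique {A : Arity OneObj} {x x' : (ComPresented K).obj A OneObj.star}
    (hx : Comb x) (hx' : Comb x') : x = x' := by
  induction hn : Nat.card A.ι using Nat.strong_induction_on generalizing A with
  | _ n ih =>
  by_cases hA : Nat.card A.ι = 2
  · rw [hx.eq_gen hA, hx'.eq_gen hA]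
  -- The same input is made the head of both combs. Their tails are then combs in the remaining
  -- inputs, to which the induction hypothesis applies.
  obtain ⟨a⟩ := A.ne
  obtain ⟨D, B, h, k, e, y, hy, ⟨d, hd⟩, rfl⟩ := hx.exists_mul hA a
  obtain ⟨D', B', h', k', e', y', hy', ⟨d', hd'⟩, rfl⟩ := hx'.exists_mul hA a
  have := subsingleton_ne h k
  have := subsingleton_ne h' k'
  obtain ⟨r, hr⟩ := exists_equiv_of_map_inl (e.symm.trans e') d d'
    (by rw [Equiv.trans_apply, ← hd, Equiv.symm_apply_apply, hd'])
  obtain ⟨p, hp⟩ := exists_equiv_two h k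
  obtain ⟨p', hp'⟩ := exists_equiv_two h' k'
  have hyr : y = (ComPresented K).relabel r y' := by
    refine ih (Nat.card B.ι) ?_ hy (hy'.relabel r) rfl
    have := card_subst D k B
    rw [← hn, Nat.card_congr e]
    omega
  obtain ⟨s, hs, hs₁, hs₂⟩ := (ComPresented K).cmp_relabel_left (p.trans p'.symm) k (j := k')
    (by rw [Equiv.trans_apply, hp, ← hp', Equiv.symm_apply_apply]) (ComPresented.gen K D' h') y
  rw [relabel_gen _ h] at hs
  rw [hs, hyr, GOperad.cmp_relabel_right, GOperad.relabel_relabel, GOperad.relabel_relabel]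
  -- Only the two label bijections remain to be compared: on the head `a` the left summand leaves no
  -- choice, and on the tail `r` was built to match.
  congr 2
  ext t
  simp only [Equiv.trans_apply]
  rcases ht : e t with c | b
  · obtain ⟨_, hc⟩ := hs₁ c
    obtain rfl : t = a := e.injective (by rw [ht, hd, Subsingleton.elim c d])
    rw [hc, hd']
    exact congrArg Sum.inl (Subsingleton.elim _ _)
  · rw [hs₂]
    have := hr b
    rw [Equiv.trans_apply, ← ht, Equiv.symm_apply_apply] at this
    exact this.symm

theorem exists_comb (A : Arity OneObj) (hA : 2 ≤ Nat.card A.ι) :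
    ∃ x : (ComPresented K).obj A OneObj.star, Comb x := by
  obtain ⟨n, hn⟩ := Nat.exists_eq_add_of_le hA
  induction n generalizing A with
  | zero => exact ⟨_, .gen A hn⟩
  | succ n ih =>
    let B : Arity OneObj := Arity.const (Fin (2 + n)) OneObj.star
    have hB : Nat.card B.ι = 2 + n := by simp [B]
    obtain ⟨y, hy⟩ := ih B (by omega) hB
    obtain ⟨e⟩ : Nonempty (A.ι ≃ (two.subst (0 : Fin 2) B).ι) := by
      refine Finite.card_eq.1 ?_
      have := card_subst two (0 : Fin 2) B
      rw [card_two] at this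
      omega
    exact ⟨_, .mul card_two (0 : Fin 2) e hy⟩

/-! ### The components are at most one-dimensional -/

/-- The span of the monomials. -/
def combSpan (K : Type x) [Field K] (A : Arity OneObj) :
    Submodule K ((ComPresented K).obj A OneObj.star) :=
  Submodule.span K {y | Comb y}

theorem relabel_mem_combSpan {A B : Arity OneObj} (e : A.ι ≃ B.ι)
    {z : (ComPresented K).obj B OneObj.star} (hz : z ∈ combSpan K B) :
    (ComPresented K).relabel e z ∈ combSpan K A := by
  induction hz using Submodule.span_induction with
  | mem y hy => exact Submodule.subset_span (Comb.relabel _ hy)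
  | zero => rw [map_zero]; exact Submodule.zero_mem _
  | add y z _ _ hy hz => rw [map_add]; exact Submodule.add_mem _ hy hz
  | smul k y _ hy => rw [map_smul]; exact Submodule.smul_mem _ k hy

theorem comp_mem_combSpan {A B : Arity OneObj} (i : A.ι)
    {y : (ComPresented K).obj A OneObj.star} {z : (ComPresented K).obj B (A.col i)}
    (hy : y ∈ combSpan K A) (hz : z ∈ combSpan K B) :
    (ComPresented K).comp i y z ∈ combSpan K (A.subst i B) := by
  have h := Submodule.apply_mem_map₂
    ((ComPresented K).comp (A := A) (B := B) (d := OneObj.star) i) hy hz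
  refine (?_ : Submodule.map₂ _ _ _ ≤ combSpan K (A.subst i B)) h
  refine (Submodule.map₂_span_span K _ _ _).trans_le (Submodule.span_le.2 ?_)
  rintro _ ⟨x, hx, y, hy, rfl⟩
  exact Submodule.subset_span (Comb.cmp hx i hy)

/-- The spans of the combs contain the generators and are stable under every operation from which
expressions are built. -/
theorem mk_mem_combSpan {A : Arity OneObj} {d : OneObj} (t : Raw K binaryGen A d) :
    (Quotient.mk (Raw.setoid (AssocRel K) A d) t : (ComPresented K).obj A OneObj.star) ∈
      combSpan K A := by
  induction t with
  | gen e => exact Submodule.subset_span (s := {y | Comb y}) (Comb.gen (K := K) _ e.down)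
  | @zero A d => exact (combSpan K A).zero_mem
  | @add A d s t ihs iht => exact (combSpan K A).add_mem ihs iht
  | @smul A d k t ih => exact (combSpan K A).smul_mem k ih
  | @act A' A d d' g f t ih =>
    have h := relabel_mem_combSpan g.e ih
    exact (congrArg (· ∈ combSpan K A')
      ((ComPresented K).act_eq_relabel g f (Quotient.mk _ t))).mpr h
  | @comp A B d i s t ihs iht => exact comp_mem_combSpan i ihs iht

/-- Every operation is a multiple of any monomial in the same inputs. -/
theorem Comb.exists_smul {A : Arity OneObj} {y : (ComPresented K).obj A OneObj.star}
    (hy : Comb y) (x : (ComPresented K).obj A OneObj.star) : ∃ k : K, x = k • y := by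
  obtain ⟨t, rfl⟩ := Quotient.exists_rep x
  have h : combSpan K A ≤ Submodule.span K {y} :=
    Submodule.span_mono fun z hz => Comb.unique hz hy
  obtain ⟨k, hk⟩ := Submodule.mem_span_singleton.1 (h (mk_mem_combSpan t))
  exact ⟨k, hk.symm⟩

theorem eq_zero_of_card_lt {A : Arity OneObj} (hA : Nat.card A.ι < 2)
    (x : (ComPresented K).obj A OneObj.star) : x = 0 := by
  obtain ⟨t, rfl⟩ := Quotient.exists_rep x
  have h : combSpan K A ≤ ⊥ :=
    Submodule.span_le.2 fun z hz => absurd (Comb.two_le_card hz) hA.not_ge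
  exact h (mk_mem_combSpan t)

/-! ### Detection by multiplicative functionals -/

/-- A family of functionals that is multiplicative and takes the value `1` on the generator. -/
structure IsMultiplicative
    (θ : ∀ A : Arity OneObj, (ComPresented K).obj A OneObj.star →ₗ[K] K) : Prop where
  map_gen : ∀ A h, θ A (gen K A h) = 1
  map_relabel : ∀ {A B : Arity OneObj} (e : A.ι ≃ B.ι) (x : (ComPresented K).obj B OneObj.star),
    θ A ((ComPresented K).relabel e x) = θ B x
  map_cmp : ∀ {A B : Arity OneObj} (i : A.ι) (x : (ComPresented K).obj A OneObj.star)
    (y : (ComPresented K).obj B OneObj.star),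
    θ (A.subst i B) ((ComPresented K).cmp i x y) = θ A x * θ B y

namespace IsMultiplicative

variable {θ : ∀ A : Arity OneObj, (ComPresented K).obj A OneObj.star →ₗ[K] K}

theorem map_comb (hθ : IsMultiplicative θ) {A : Arity OneObj}
    {x : (ComPresented K).obj A OneObj.star}
    (hx : Comb x) : θ A x = 1 := by
  induction hx with
  | gen A h => exact hθ.map_gen A h
  | mul h k e hy ih => rw [hθ.map_relabel, hθ.map_cmp, hθ.map_gen, ih, one_mul]

/-- In arity at least two the component is spanned by a comb, whose value is 1; in lower arity it is
zero. -/
theorem injective (hθ : IsMultiplicative θ) (A : Arity OneObj) : Function.Injective (θ A) := by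
  rw [injective_iff_map_eq_zero]
  intro x hx
  by_cases hA : 2 ≤ Nat.card A.ι
  · obtain ⟨y, hy⟩ := exists_comb (K := K) A hA
    obtain ⟨k, rfl⟩ := hy.exists_smul x
    rw [map_smul, hθ.map_comb hy, smul_eq_mul, mul_one] at hx
    rw [hx, zero_smul]
  · exact eq_zero_of_card_lt (not_le.1 hA) x

end IsMultiplicative

end ComPresented

/-! ### The operad of scalars, target of the detecting morphisms -/

namespace GOperad

/-- The operad with all components equal to `K` and composition the multiplication of scalars. -/
def scalars (K : Type x) [Field K] (V : Type*) [Groupoid V] : GOperad K V where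
  obj _ _ := K
  act _ _ := LinearMap.id
  comp _ := LinearMap.mul K K
  act_id _ := rfl
  act_act _ _ _ _ _ := rfl
  comp_act _ _ _ _ _ _ := rfl
  comp_seq _ _ a b c := mul_assoc a b c
  comp_par _ _ _ a b c := mul_right_comm a b c

end GOperad

/-! ### The isomorphism of the presented operad with `Com` -/

namespace ComPresented

variable {K : Type x} [Field K]

/-- The morphism to the commutative operad sending the generator to the commutative product. -/
def toCom (K : Type x) [Field K] : GOperad.Hom (𝟭 OneObj) (ComPresented K) (Com K) :=
  GOperad.lift (E := binaryGen) (Com K) (fun A _ h => (⟨1, Or.inl (h.down.ge)⟩ : comObj K A))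
    (fun _ _ _ => rfl) (by rintro A d s t ⟨⟩; rfl)

theorem toCom_relabel {A B : Arity OneObj} (e : A.ι ≃ B.ι)
    (x : (ComPresented K).obj B OneObj.star) :
    ((toCom K).app A OneObj.star ((ComPresented K).relabel e x)).1 =
      ((toCom K).app B OneObj.star x).1 :=
  congrArg Subtype.val ((toCom K).app_act (Arity.homOfEquiv e) (𝟙 OneObj.star) x)

theorem toCom_cmp {A B : Arity OneObj} (i : A.ι)
    (x : (ComPresented K).obj A OneObj.star) (y : (ComPresented K).obj B OneObj.star) :
    ((toCom K).app (A.subst i B) OneObj.star ((ComPresented K).cmp i x y)).1 =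
      ((toCom K).app A OneObj.star x).1 * ((toCom K).app B OneObj.star y).1 :=
  congrArg Subtype.val ((toCom K).app_comp i x y)

theorem toCom_bijective (A : Arity OneObj) :
    Function.Bijective ((toCom K).app A OneObj.star) := by
  let θ : ∀ A : Arity OneObj, (ComPresented K).obj A OneObj.star →ₗ[K] K :=
    fun A => (comObj K A).subtype ∘ₗ (toCom K).app A OneObj.star
  have hθ : IsMultiplicative θ :=
    ⟨fun _ _ => rfl, fun e x => toCom_relabel e x, fun i x y => toCom_cmp i x y⟩
  refine ⟨fun x y hxy => hθ.injective A (congrArg Subtype.val hxy), ?_⟩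
  -- A scalar in arity at least two is hit by that multiple of a comb; in lower arity only 0 is
  -- left.
  rintro ⟨k, hk | rfl⟩
  · obtain ⟨y, hy⟩ := exists_comb (K := K) A hk
    refine ⟨k • y, Subtype.ext ?_⟩
    rw [map_smul]
    exact (congrArg (k * ·) (hθ.map_comb hy)).trans (mul_one k)
  · exact ⟨0, map_zero _⟩

/-- The isomorphism of the components with those of the commutative operad. -/
noncomputable def comEquiv (K : Type x) [Field K] (A : Arity OneObj) (d : OneObj) :
    (ComPresented K).obj A d ≃ₗ[K] (Com K).obj A d :=
  LinearEquiv.ofBijective ((toCom K).app A d) (toCom_bijective A)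

/-- A morphism out of the presented commutative operad, as a morphism out of `Com`. -/
noncomputable def homOfCom {V : Type*} [Groupoid V] {F : OneObj ⥤ V} {Q : GOperad K V}
    (ψ : GOperad.Hom F (ComPresented K) Q) : GOperad.Hom F (Com K) Q where
  app A d := ψ.app A d ∘ₗ (comEquiv K A d).symm.toLinearMap
  app_act {A' A d d'} g f α := by
    obtain ⟨a, rfl⟩ := (comEquiv K A d).surjective α
    have h : (comEquiv K A' d').symm ((Com K).act g f (comEquiv K A d a)) =
        (ComPresented K).act g f a := by
      rw [LinearEquiv.symm_apply_eq]
      exact ((toCom K).app_act g f a).symm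
    have := ψ.app_act g f a
    rw [LinearMap.comp_apply, LinearMap.comp_apply]
    exact (congrArg (ψ.app A' d') h).trans (this.trans
      (congrArg (fun z => Q.act _ _ (ψ.app A d z)) ((comEquiv K A d).symm_apply_apply a).symm))
  app_comp {A B d} i α β := by
    obtain ⟨a, rfl⟩ := (comEquiv K A d).surjective α
    obtain ⟨b, rfl⟩ := (comEquiv K B (A.col i)).surjective β
    have h : (comEquiv K (A.subst i B) d).symm
        ((Com K).comp i (comEquiv K A d a) (comEquiv K B (A.col i) b)) =
        (ComPresented K).comp i a b := by
      rw [LinearEquiv.symm_apply_eq]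
      exact ((toCom K).app_comp i a b).symm
    have := ψ.app_comp i a b
    simp only [LinearMap.comp_apply]
    refine (congrArg (ψ.app _ d) h).trans (this.trans ?_)
    exact congrArg₂ (fun y z => Q.act _ _ (Q.comp (A := A.map F) i (ψ.app A d y)
      (ψ.app B (A.col i) z)))
      ((comEquiv K A d).symm_apply_apply a).symm
      ((comEquiv K B (A.col i)).symm_apply_apply b).symm

theorem homOfCom_mu {V : Type*} [Groupoid V] {F : OneObj ⥤ V} {Q : GOperad K V}
    (ψ : GOperad.Hom F (ComPresented K) Q) :
    (homOfCom ψ).app two OneObj.star (Com.mu K) =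
      ψ.app two OneObj.star (GOperad.presentedGen K (AssocRel K) binaryGen.mu) := by
  refine congrArg (ψ.app two OneObj.star) ?_
  rw [LinearEquiv.coe_coe, LinearEquiv.symm_apply_eq]
  rfl

theorem isIsoOnto_homOfCom {V : Type*} [Groupoid V] {F : OneObj ⥤ V} {Q : GOperad K V}
    {ψ : GOperad.Hom F (ComPresented K) Q} {S : Q.Suboperad} (h : ψ.IsIsoOnto S) :
    (homOfCom ψ).IsIsoOnto S where
  full := h.full
  faithful := h.faithful
  obj_injective := h.obj_injective
  app_injective A d := (h.app_injective A d).comp (comEquiv K A d).symm.injective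
  range_eq A d := by
    rw [← h.range_eq A d]
    exact LinearMap.range_comp_of_range_eq_top _ (comEquiv K A d).symm.range
  support := h.support

end ComPresented

/-! ### The suboperad generated by a commutative and associative product -/

theorem Arity.hom_ext_of_subsingleton {V : Type*} [Groupoid V] {A B : Arity V}
    (hAB : ∀ i j, Subsingleton (A.col i ⟶ B.col j)) {g h : A ⟶ B} (he : ∀ i, g.e i = h.e i) :
    g = h :=
  Arity.hom_ext he fun _ => (hAB _ _).elim _ _

/-- Undoes the `mapSubst` in the composition law of a morphism, so that a composite of images can be
written as an action on an image. -/
theorem Arity.exists_comp_mapSubst {U : Type*} [Groupoid U] {V : Type*} [Groupoid V] (F : U ⥤ V)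
    (A : Arity U) (i : A.ι) (B : Arity U) :
    ∃ r : (A.map F).subst i (B.map F) ⟶ (A.subst i B).map F, r ≫ mapSubst F A i B = 𝟙 _ := by
  refine ⟨⟨Equiv.refl _, fun j => match j with
    | Sum.inl a => 𝟙 (F.obj (A.col a.1))
    | Sum.inr b => 𝟙 (F.obj (B.col b))⟩, Arity.hom_ext (fun _ => rfl) ?_⟩
  rintro (a | b) <;> exact (Category.comp_id _).trans (Category.comp_id _)

/-- A commutative and associative product on the colour `e`, whose iterates are detected by a
multiplicative functional; the colour `e` has no automorphisms and is isomorphic to no other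
colour. -/
structure IsDetectedProduct {K : Type x} [Field K] {V : Type*} [Groupoid V] {Q : GOperad K V}
    {e : V} (η : Q.obj (Arity.const (Fin 2) e) e) : Prop where
  subsingleton_end : Subsingleton (e ⟶ e)
  eq_of_hom : ∀ {a : V}, (a ⟶ e) → a = e
  symm : ∀ σ : Equiv.Perm (Fin 2), Q.act (Arity.constHom σ e) (𝟙 _) η = η
  assoc : Q.comp (A := Arity.const (Fin 2) e) (0 : Fin 2) η η =
    Q.act (Arity.ternaryHom e) (𝟙 _) (Q.comp (A := Arity.const (Fin 2) e) (1 : Fin 2) η η)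
  detect : ∃ ε : GOperad.Hom (𝟭 V) Q (GOperad.scalars K V), ε.app _ _ η = (1 : K)

namespace IsDetectedProduct

variable {K : Type x} [Field K] {V : Type*} [Groupoid V] {Q : GOperad K V}
    {e : V} {η : Q.obj (Arity.const (Fin 2) e) e}

/-- The product of two labelled inputs. -/
noncomputable def genImage (η : Q.obj (Arity.const (Fin 2) e) e) (A : Arity OneObj)
    (h : Nat.card A.ι = 2) : Q.obj (A.map ((Functor.const OneObj).obj e)) e :=
  Q.act (A := Arity.const (Fin 2) e)
    ⟨(Finite.card_eq.1 (h.trans ComPresented.card_two.symm)).some, fun _ => 𝟙 e⟩ (𝟙 e) η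

/-- The arbitrary bijection chosen in `genImage` does not matter: two choices differ by a
permutation that fixes `η`, and the colour `e` has only the identity automorphism. -/
theorem act_eq_genImage (hη : IsDetectedProduct η) {A : Arity OneObj} (h : Nat.card A.ι = 2)
    (g : A.map ((Functor.const OneObj).obj e) ⟶ Arity.const (Fin 2) e) (f : e ⟶ e) :
    Q.act g f η = genImage η A h := by
  have := hη.subsingleton_end
  rw [genImage]
  set r : A.ι ≃ Fin 2 := (Finite.card_eq.1 (h.trans ComPresented.card_two.symm)).some
  refine Eq.trans ?_ (congrArg (Q.act _ _) (hη.symm (r.symm.trans g.e)))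
  rw [Q.act_act]
  refine Q.act_congr (Arity.hom_ext_of_subsingleton (fun _ _ => this) fun i => ?_)
    (Subsingleton.elim _ _) η
  exact congrArg g.e (r.symm_apply_apply i).symm

/-- The morphism sending the generator to the product. -/
noncomputable def ofPresented (hη : IsDetectedProduct η) :
    GOperad.Hom ((Functor.const OneObj).obj e) (ComPresented K) Q :=
  GOperad.lift (E := binaryGen) Q (fun A _ h => genImage η A h.down)
    (fun g f h => by
      refine Eq.trans ?_ (Q.act_act _ _ _ _ η).symm
      exact (hη.act_eq_genImage _ _ _).symm)
    (by
      have := hη.subsingleton_end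
      rintro A d s t ⟨⟩
      -- On the standard profile the chosen bijection may be replaced by the identity.
      have hμ : genImage η ComPresented.two ComPresented.card_two = η :=
        (hη.act_eq_genImage ComPresented.card_two (𝟙 _) (𝟙 _)).symm.trans (Q.act_id η)
      simp only [GOperad.evalRaw]
      refine (congrArg₂ (fun y z => Q.act _ _
        (Q.comp (A := Arity.const (Fin 2) e) (0 : Fin 2) y z)) hμ hμ).trans ?_
      refine Eq.trans ?_ (congrArg₂ (fun y z => Q.act _ _ (Q.act _ _
        (Q.comp (A := Arity.const (Fin 2) e) (1 : Fin 2) y z))) hμ hμ).symm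
      refine (congrArg (Q.act _ _) hη.assoc).trans ?_
      refine (Q.act_act _ _ _ _ _).trans (Eq.trans ?_ (Q.act_act _ _ _ _ _).symm)
      refine Q.act_congr (Arity.hom_ext_of_subsingleton ?_ ?_) (this.elim _ _) _
      · rintro (i | i) (j | j) <;> exact this
      · exact fun i => rfl)

theorem ofPresented_mu (hη : IsDetectedProduct η) :
    hη.ofPresented.app ComPresented.two OneObj.star
      (GOperad.presentedGen K (AssocRel K) binaryGen.mu) = η :=
  (hη.act_eq_genImage ComPresented.card_two (𝟙 _) (𝟙 _)).symm.trans (Q.act_id η)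

/-- Followed by the detecting morphism `ε`, the map becomes a multiplicative functional, and these
are injective. -/
theorem ofPresented_injective (hη : IsDetectedProduct η) (A : Arity OneObj) (d : OneObj) :
    Function.Injective (hη.ofPresented.app A d) := by
  obtain ⟨ε, hε⟩ := hη.detect
  let θ : ∀ A : Arity OneObj, (ComPresented K).obj A OneObj.star →ₗ[K] K :=
    fun A => (ε.app _ _ : Q.obj (A.map ((Functor.const OneObj).obj e)) e →ₗ[K] K) ∘ₗ
      hη.ofPresented.app A OneObj.star
  have hθ : ComPresented.IsMultiplicative θ := by
    refine ⟨fun A h => ?_, fun g x => ?_, fun i x y => ?_⟩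
    · exact (ε.app_act _ _ η).trans hε
    · exact (congrArg (ε.app _ _) (hη.ofPresented.app_act (Arity.homOfEquiv g) (𝟙 _) x)).trans
        (ε.app_act _ _ _)
    · exact (congrArg (ε.app _ _) (hη.ofPresented.app_comp i x y)).trans
        ((ε.app_act _ _ _).trans (ε.app_comp _ _ _))
  exact Function.Injective.of_comp (hθ.injective A)

/-- The closure of the image of `ofPresented` under the groupoid. -/
noncomputable def image (hη : IsDetectedProduct η) : Q.Suboperad where
  carrier A d := Submodule.span K {x | ∃ (B : Arity OneObj)
    (g : A ⟶ B.map ((Functor.const OneObj).obj e)) (f : e ⟶ d)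
    (t : (ComPresented K).obj B OneObj.star),
    x = Q.act g f (hη.ofPresented.app B OneObj.star t)}
  act_mem {A' A d d'} g f α hα := by
    induction hα using Submodule.span_induction with
    | mem y hy =>
      obtain ⟨B, g', f', t, rfl⟩ := hy
      exact Submodule.subset_span ⟨B, g ≫ g', f' ≫ f, t, Q.act_act _ _ _ _ _⟩
    | zero => rw [map_zero]; exact Submodule.zero_mem _
    | add y z _ _ hy hz => rw [map_add]; exact Submodule.add_mem _ hy hz
    | smul k y _ hy => rw [map_smul]; exact Submodule.smul_mem _ k hy
  comp_mem {A B d} i α β hα hβ := by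
    have h := Submodule.apply_mem_map₂ (Q.comp (A := A) (B := B) (d := d) i) hα hβ
    rw [Submodule.map₂_span_span] at h
    refine Submodule.span_mono ?_ h
    rintro _ ⟨_, ⟨D, g, f, s, rfl⟩, _, ⟨D', g', f', t, rfl⟩, rfl⟩
    have := hη.subsingleton_end
    -- On the internal edge, `f'` leads from `e` to the colour of input `i` and `g.f i` leads back
    -- to `e`. Equivariance brings them together, and their composite is an endomorphism of `e`,
    -- hence the identity.
    have h₁ : Q.act g' f' (hη.ofPresented.app D' OneObj.star t) =
        Q.act g' (𝟙 _) (Q.act (𝟙 _) f' (hη.ofPresented.app D' OneObj.star t)) := by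
      rw [Q.act_act, Category.comp_id, Category.comp_id]
    have h₂ : Q.act (𝟙 _) (g.f i) (Q.act (𝟙 _) f' (hη.ofPresented.app D' OneObj.star t)) =
        hη.ofPresented.app D' OneObj.star t := by
      rw [Q.act_act]
      refine (Q.act_congr (Category.comp_id _) (this.elim _ _) _).trans (Q.act_id _)
    have h₃ := hη.ofPresented.app_comp (g.e i) s t
    obtain ⟨r, hr⟩ := Arity.exists_comp_mapSubst ((Functor.const OneObj).obj e) D (g.e i) D'
    refine ⟨D.subst (g.e i) D', Arity.substHom g i g' ≫ r, f,
      (ComPresented K).comp (g.e i) s t, ?_⟩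
    refine (congrArg (Q.comp i _) h₁).trans ((Q.comp_act g f i g' _ _).trans ?_)
    refine (congrArg (fun z => Q.act _ _ (Q.comp (g.e i) _ z)) h₂).trans ?_
    refine Eq.trans ?_ (congrArg (Q.act _ _) h₃).symm
    refine Eq.trans ?_ (Q.act_act _ _ _ _ _).symm
    refine Q.act_congr ?_ (Category.id_comp f).symm _
    rw [Category.assoc, hr, Category.comp_id]

theorem range_le_adjoin (hη : IsDetectedProduct η) (A : Arity OneObj) (d : OneObj) :
    LinearMap.range (hη.ofPresented.app A d) ≤
      (Q.adjoin η).carrier (A.map ((Functor.const OneObj).obj e)) e := by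
  have hmem : η ∈ (Q.adjoin η).carrier _ _ := (Submodule.mem_iInf _).2 fun S => S.2
  rintro _ ⟨x, rfl⟩
  obtain ⟨t, rfl⟩ := Quotient.exists_rep x
  change GOperad.evalRaw Q _ t ∈ _
  induction t with
  | gen e => exact (Q.adjoin η).act_mem _ _ hmem
  | zero => exact Submodule.zero_mem _
  | add s t ihs iht => exact Submodule.add_mem _ ihs iht
  | smul k t ih => exact Submodule.smul_mem _ k ih
  | act g f t ih => exact (Q.adjoin η).act_mem _ _ ih
  | comp i s t ihs iht => exact (Q.adjoin η).act_mem _ _ ((Q.adjoin η).comp_mem i ihs iht)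

theorem adjoin_le_image (hη : IsDetectedProduct η) (A : Arity V) (d : V) :
    (Q.adjoin η).carrier A d ≤ hη.image.carrier A d := by
  refine iInf_le (fun S : {S : Q.Suboperad // η ∈ S.carrier _ _} => S.1.carrier A d)
    ⟨hη.image, Submodule.subset_span ⟨ComPresented.two, 𝟙 _, 𝟙 _,
      GOperad.presentedGen K (AssocRel K) binaryGen.mu, ?_⟩⟩
  exact (hη.ofPresented_mu.symm.trans (Q.act_id _).symm)

theorem isIsoOnto_ofPresented (hη : IsDetectedProduct η) :
    hη.ofPresented.IsIsoOnto (Q.adjoin η) where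
  full := ⟨fun {a b} f => ⟨eqToHom (Subsingleton.elim _ _), hη.subsingleton_end.elim _ _⟩⟩
  faithful := ⟨fun {a b} f g _ => Subsingleton.elim f g⟩
  obj_injective _ _ _ := Subsingleton.elim _ _
  app_injective := hη.ofPresented_injective
  range_eq A d := by
    have := hη.subsingleton_end
    refine le_antisymm (hη.range_le_adjoin A d) ((hη.adjoin_le_image _ _).trans ?_)
    refine Submodule.span_le.2 ?_
    rintro _ ⟨B, g, f, t, rfl⟩
    -- Between profiles of constant colour `e` a morphism is just a bijection of labels, so the
    -- closure under the groupoid adds nothing here.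
    refine ⟨(ComPresented K).relabel g.e t, ?_⟩
    refine (hη.ofPresented.app_act (Arity.homOfEquiv g.e) (𝟙 _) t).trans ?_
    refine Q.act_congr (Arity.hom_ext_of_subsingleton ?_ ?_) (this.elim _ _) _
    · exact fun _ _ => this
    · exact fun _ => rfl
  support A d h := by
    -- A non-zero span needs at least one spanning element, and the morphisms in it force all
    -- colours to equal `e`.
    have : ∃ (B : Arity OneObj) (_ : A ⟶ B.map ((Functor.const OneObj).obj e)),
        Nonempty (e ⟶ d) := by
      by_contra hne
      refine h (le_bot_iff.1 ((hη.adjoin_le_image A d).trans (Submodule.span_le.2 ?_)))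
      rintro _ ⟨B, g, f, t, rfl⟩
      exact absurd ⟨B, g, ⟨f⟩⟩ hne
    obtain ⟨B, g, ⟨f⟩⟩ := this
    exact ⟨fun i => ⟨OneObj.star, (hη.eq_of_hom (g.f i)).symm⟩,
      ⟨OneObj.star, (hη.eq_of_hom (Groupoid.inv f)).symm⟩⟩

end IsDetectedProduct

/-! ### The empty profile -/

theorem BiProfile.subsingleton_end_empty (C : Type u) :
    Subsingleton (BiProfile.empty C ⟶ BiProfile.empty C) := by
  refine ⟨fun f g => Prod.ext (Quiver.Hom.unop_inj (Subtype.ext (Equiv.ext fun k => ?_)))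
    (Subtype.ext (Equiv.ext fun k => ?_))⟩
  · exact Fin.elim0 k
  · exact Fin.elim0 k

theorem BiProfile.eq_empty_of_hom {C : Type u} {a : BiProfile C} (g : a ⟶ BiProfile.empty C) :
    a = BiProfile.empty C := by
  have h₁ : List.length a.1.unop = 0 :=
    Fin.equiv_iff_eq.1 ⟨BiProfile.inEquiv g⟩
  have h₂ : List.length a.2 = 0 :=
    Fin.equiv_iff_eq.1 ⟨BiProfile.outEquiv g⟩
  exact Prod.ext (congrArg Opposite.op (List.length_eq_zero_iff.1 h₁))
    (List.length_eq_zero_iff.1 h₂)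

/-- Empty profiles leave no inputs or outputs to wire. Graph identities for `η` follow without
computing any substitution. The colours are only assumed equal to the empty one pointwise, so that
composite profiles are covered. -/
theorem Wiring.subsingleton_of_empty {C : Type u} {A : Arity (BiProfile C)} {d : BiProfile C}
    (hA : ∀ i, A.col i = BiProfile.empty C) (hd : d = BiProfile.empty C) :
    Subsingleton (Wiring A d) := by
  have hy : ∀ p : BiProfile C, p = BiProfile.empty C → p.Out → False := by
    rintro _ rfl k
    exact Fin.elim0 k
  subst hd
  exact ⟨fun G H => Wiring.ext (funext fun y => (hy _ (hA y.1) y.2).elim)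
    (funext fun k => Fin.elim0 k)⟩

/-- Symmetry and associativity come from uniqueness of the graph on empty vertices; associativity is
then one of the defining relations. The detecting morphism sends every generator to 1, so both sides
of every relation evaluate to `1 * 1`. -/
theorem WOperad.isDetectedProduct_eta (K : Type x) [Field K] (C : Type u) :
    IsDetectedProduct (WOperad.eta K C) where
  subsingleton_end := BiProfile.subsingleton_end_empty C
  eq_of_hom := BiProfile.eq_empty_of_hom
  symm σ := by
    refine (Quotient.sound (Raw.Rel.gen_act _ _ _)).trans ?_
    refine congrArg (GOperad.presentedGen K (WheeledRel K C)) (Subtype.ext ?_)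
    exact (Wiring.subsingleton_of_empty (fun _ => rfl) rfl).elim _ _
  assoc := by
    -- Unification takes all four generators to be `η` and `φ` to be `ternaryHom`.
    refine Quotient.sound (Raw.Rel.rel (WheeledRel.mk _ _ _ _ _ _ _ ?_))
    exact (Wiring.subsingleton_of_empty (by rintro (i | i) <;> rfl) rfl).elim _ _
  detect := ⟨GOperad.lift (E := wheeledGen C) (GOperad.scalars K (BiProfile C))
    (fun _ _ _ => (1 : K)) (fun _ _ _ => rfl) (by rintro A d s t ⟨⟩; rfl), rfl⟩

/-- The same argument applies: `η` is a horizontal generator here too, and the relations again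
equate composites of two generators. -/
theorem POperad.isDetectedProduct_eta (K : Type x) [Field K] (C : Type u) :
    IsDetectedProduct (POperad.eta K C) where
  subsingleton_end := BiProfile.subsingleton_end_empty C
  eq_of_hom := BiProfile.eq_empty_of_hom
  symm σ := by
    refine (Quotient.sound (Raw.Rel.gen_act _ _ _)).trans ?_
    refine congrArg (GOperad.presentedGen K (PropRel K C)) (Subtype.ext ?_)
    exact (Wiring.subsingleton_of_empty (fun _ => rfl) rfl).elim _ _
  assoc := by
    refine Quotient.sound (Raw.Rel.rel (PropRel.mk _ _ _ _ _ _ _ ?_))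
    exact (Wiring.subsingleton_of_empty (by rintro (i | i) <;> rfl) rfl).elim _ _
  detect := ⟨GOperad.lift (E := propGen C) (GOperad.scalars K (BiProfile C))
    (fun _ _ _ => (1 : K)) (fun _ _ _ => rfl) (by rintro A d s t ⟨⟩; rfl), rfl⟩

theorem mainTheorem8 (K : Type x) [Field K] [CharZero K] (C : Type u) [Nonempty C] :
    ((∀ σ : Equiv.Perm (Fin 2),
        (WOperad K C).act (Arity.constHom σ (BiProfile.empty C)) (𝟙 _) (WOperad.eta K C) = WOperad.eta K C) ∧
      (WOperad K C).comp (A := Arity.const (Fin 2) (BiProfile.empty C)) (0 : Fin 2)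
          (WOperad.eta K C) (WOperad.eta K C) =
        (WOperad K C).act (Arity.ternaryHom (BiProfile.empty C)) (𝟙 _)
          ((WOperad K C).comp (A := Arity.const (Fin 2) (BiProfile.empty C)) (1 : Fin 2)
            (WOperad.eta K C) (WOperad.eta K C)) ∧
      (∃ φ : GOperad.Hom (emptyColour C) (Com K) (WOperad K C),
        φ.app (Arity.const (Fin 2) OneObj.star) OneObj.star (Com.mu K) = WOperad.eta K C ∧
          φ.IsIsoOnto ((WOperad K C).adjoin (WOperad.eta K C))) ∧
      (∃ ψ : GOperad.Hom (emptyColour C) (ComPresented K) (WOperad K C),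
        ψ.app (Arity.const (Fin 2) OneObj.star) OneObj.star
            (GOperad.presentedGen K (AssocRel K) binaryGen.mu) = WOperad.eta K C ∧
          ψ.IsIsoOnto ((WOperad K C).adjoin (WOperad.eta K C)))) ∧
    ((∀ σ : Equiv.Perm (Fin 2),
        (POperad K C).act (Arity.constHom σ (BiProfile.empty C)) (𝟙 _) (POperad.eta K C) = POperad.eta K C) ∧
      (POperad K C).comp (A := Arity.const (Fin 2) (BiProfile.empty C)) (0 : Fin 2)
          (POperad.eta K C) (POperad.eta K C) =
        (POperad K C).act (Arity.ternaryHom (BiProfile.empty C)) (𝟙 _)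
          ((POperad K C).comp (A := Arity.const (Fin 2) (BiProfile.empty C)) (1 : Fin 2)
            (POperad.eta K C) (POperad.eta K C)) ∧
      (∃ φ : GOperad.Hom (emptyColour C) (Com K) (POperad K C),
        φ.app (Arity.const (Fin 2) OneObj.star) OneObj.star (Com.mu K) = POperad.eta K C ∧
          φ.IsIsoOnto ((POperad K C).adjoin (POperad.eta K C))) ∧
      (∃ ψ : GOperad.Hom (emptyColour C) (ComPresented K) (POperad K C),
        ψ.app (Arity.const (Fin 2) OneObj.star) OneObj.star
            (GOperad.presentedGen K (AssocRel K) binaryGen.mu) = POperad.eta K C ∧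
          ψ.IsIsoOnto ((POperad K C).adjoin (POperad.eta K C)))) := by
  have hW := WOperad.isDetectedProduct_eta K C
  have hP := POperad.isDetectedProduct_eta K C
  exact ⟨⟨hW.symm, hW.assoc,
      ⟨ComPresented.homOfCom hW.ofPresented,
        (ComPresented.homOfCom_mu _).trans hW.ofPresented_mu,
        ComPresented.isIsoOnto_homOfCom hW.isIsoOnto_ofPresented⟩,
      ⟨hW.ofPresented, hW.ofPresented_mu, hW.isIsoOnto_ofPresented⟩⟩,
    ⟨hP.symm, hP.assoc,
      ⟨ComPresented.homOfCom hP.ofPresented,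
        (ComPresented.homOfCom_mu _).trans hP.ofPresented_mu,
        ComPresented.isIsoOnto_homOfCom hP.isIsoOnto_ofPresented⟩,
      ⟨hP.ofPresented, hP.ofPresented_mu, hP.isIsoOnto_ofPresented⟩⟩⟩
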